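/- **Setting.** Let $\gamma:[0,1]\to\mathbb R^3$ be a simple (injective) open curve. For a unit vector $\xi\in S^2$ let $\gamma_\xi$ be the projection of $\gamma$ to the plane with normal vector $\xi$. The projection is *generic* if its one-sided tangent vectors do not vanish, left and right tangent vectors are nowhere antiparallel, and its only singularities are finitely many transversal double points, none of which is an end point or a corner; then $\gamma_\xi$ is a knotoid diagram. For a knotoid diagram $D$ let $wr(D)$ be its writhe and $$\langle D\rangle=\sum_S A^{\sigma(S)}d^{\,\|S\|-1},\qquad d=-A^2-A^{-2},$$ its bracket polynomial, where $S$ runs over the states of $D$ (choices of an $A$- or a $B$-smoothing at each crossing), $\sigma(S)$ is the number of $A$- minus the number of $B$-smoothings, and $\|S\|$ is the number of components of the smoothed diagram. The normalized bracket polynomial of $\gamma$ is the coefficientwise spherical average $$f_\gamma=\frac1{4\pi}\int_{\xi\in S^2}(-A^3)^{-wr(\gamma_\xi)}\,\langle\gamma_\xi\rangle\,dS .$$ For $m\in\mathbb N$ let $L_m$ be the space of real Laurent polynomials $\sum_{|k|\le m}a_kA^k$, with the Euclidean norm of the coefficients. **Theorem.** 1. *(Polygonal chains.)* Let $n\ge1$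 and let $EW_n\subset(\mathbb R^3)^{n+1}$ be the space of vertex sequences $(p_0,\dots,p_n)$ of open polygonal chains with $n$ edges and without self-intersections. There is an $m$, depending only on $n$, such that for every chain $E\in EW_n$ almost every projection of $E$ is generic, all coefficients of $(-A^3)^{-wr(E_\xi)}\langle E_\xi\rangle$ are integrable over $\xi\in S^2$, and $f_E\in L_m$; and the map $EW_n\to L_m$, $E\mapsto f_E$, is a continuous function of the chain coordinates $(p_0,\dots,p_n)$. 2. *(General curves.)* For $M\in\mathbb N$ let $\mathcal C_M$ be the set of simple open piecewise $C^1$ curves $\gamma:[0,1]\to\mathbb R^3$ (parametrized with non-vanishing one-sided tangent vectors, left and right tangent vectors being nowhere antiparallel) for which almost every projection is generic and has at most $M$ crossings. There is an $m$, depending only on $M$, such that for every $\gamma\in\mathcal C_M$ the coefficients of $(-A^3)^{-wr(\gamma_\xi)}\langle\gamma_\xi\rangle$ are integrable over $\xi\in S^2$ and $f_\gamma\in L_m$; and $\gamma\mapsto f_\gamma$ is continuous on $\mathcal C_M$ for the $C^1$-distance, that is: for every $\gamma\in\mathcal C_M$ and $\varepsilon>0$ there is a $\delta>0$ such that $\|f_\gamma-f_\eta\|<\varepsilon$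 for every $\eta\in\mathcal C_M$ for which $\gamma-\eta$ is bounded by $\delta$ and is Lipschitz with constant $\delta$ on $[0,1]$. -/

import Mathlib

open MeasureTheory Set
open scoped LaurentPolynomial

noncomputable section

/-! Oriented diagrams of arcs, recorded by their signed Gauss diagrams, and the bracket. -/

/-- A crossing of an arc diagram. Passages through crossings are numbered `0, 1, 2, …` along the
arc; the crossing is met at the passages number `fst < snd`, and `sign` is its sign. -/
structure Chord where
  fst : ℕ
  snd : ℕ
  sign : SignType

/-- The signed Gauss diagram of an arc diagram: the set of its crossings. A diagram with `m`
crossings has the `2 m` passages `0, …, 2 m - 1`. -/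
abbrev GaussDiagram := Finset Chord

namespace GaussDiagram

/-- The writhe of the diagram: the sum of the signs of its crossings. -/
def writhe (D : GaussDiagram) : ℤ := ∑ c ∈ D, (c.sign : ℤ)

open Classical in
/-- The `2 m` passages cut the arc into the pieces `0, …, 2 m`; piece `k` runs into passage `k`
and piece `k + 1` runs out of it. A state `S` is given by the set of crossings with label `A`
(`+1`); the others have label `B` (`-1`). The `A`-smoothing opens the two regions that the
overcrossing line sweeps when turned counterclockwise; at a positive crossing this is the smoothing
that respects the orientation (in-pieces are joined to out-pieces), at a negative crossing it is
the other one (in joined to in, out to out), and vice versa for the `B`-smoothing.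
`Joined D S i j` says that a smoothing of the state `S` joins piece `i` to piece `j`. -/
def Joined (D S : GaussDiagram) (i j : Fin (2 * D.card + 1)) : Prop :=
  ∃ c ∈ D,
    if (c ∈ S ↔ c.sign = 1) then
      ((i : ℕ) = c.fst ∧ (j : ℕ) = c.snd + 1) ∨ ((i : ℕ) = c.snd ∧ (j : ℕ) = c.fst + 1)
    else
      ((i : ℕ) = c.fst ∧ (j : ℕ) = c.snd) ∨ ((i : ℕ) = c.fst + 1 ∧ (j : ℕ) = c.snd + 1)

/-- The number `‖S‖` of components of the state `S`: the classes of pieces for the equivalence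
relation generated by `Joined D S`. -/
def components (D S : GaussDiagram) : ℕ := Nat.card (Quot (Joined D S))

/-- The sum `σ(S)` of the labels of the state `S`. -/
def labelSum (D S : GaussDiagram) : ℤ := (S.card : ℤ) - ((D.card : ℤ) - (S.card : ℤ))

/-- The Kauffman bracket `∑_S A ^ σ(S) * d ^ (‖S‖ - 1)` with `d = -A² - A⁻²`; the variable `A` is
`LaurentPolynomial.T 1`. (There is always at least one component.) -/
def bracket (D : GaussDiagram) : ℝ[T;T⁻¹] :=
  ∑ S ∈ D.powerset, LaurentPolynomial.T (labelSum D S) *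
    (-LaurentPolynomial.T 2 - LaurentPolynomial.T (-2)) ^ (components D S - 1)

/-- `-A³` as an invertible Laurent polynomial. -/
def negCube : ℝ[T;T⁻¹]ˣ where
  val := -LaurentPolynomial.T 3
  inv := -LaurentPolynomial.T (-3)
  val_inv := by rw [neg_mul_neg, ← LaurentPolynomial.T_add]; simp
  inv_val := by rw [neg_mul_neg, ← LaurentPolynomial.T_add]; simp

/-- `(-A³) ^ (-wr(D)) * ⟨D⟩`. -/
def normalized (D : GaussDiagram) : ℝ[T;T⁻¹] :=
  ((negCube ^ (-D.writhe) : ℝ[T;T⁻¹]ˣ) : ℝ[T;T⁻¹]) * D.bracket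

end GaussDiagram

/-! Curves in 3-space and their projections. Curves are parametrized by `[0, 1]`; values of the
functions outside `[0, 1]` play no role. -/

/-- Euclidean 3-space. -/
abbrev E3 := EuclideanSpace ℝ (Fin 3)

/-- Projection directions: unit vectors. -/
abbrev Direction := Metric.sphere (0 : E3) 1

/-- The area measure of the unit sphere (of total mass `4 π`). -/
def sphereArea : Measure Direction := (volume : Measure E3).toSphere

/-- The scalar triple product `(u, v, w)`. -/
def tripleProduct (u v w : E3) : ℝ := Matrix.det (Matrix.of ![u.ofLp, v.ofLp, w.ofLp])

/-- Orthogonal projection to the plane through `0` with normal vector `ξ`. -/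
def projectAlong (ξ : Direction) (x : E3) : E3 := x - inner ℝ (ξ : E3) x • (ξ : E3)

/-- The crossings of the projection of `γ` in the direction `ξ`: pairs `s < t` of parameters whose
points have the same projection. -/
def crossings (γ : ℝ → E3) (ξ : Direction) : Set (ℝ × ℝ) :=
  {q | 0 ≤ q.1 ∧ q.1 < q.2 ∧ q.2 ≤ 1 ∧ projectAlong ξ (γ q.1) = projectAlong ξ (γ q.2)}

/-- The parameters at which the projection passes through a crossing. -/
def passages (γ : ℝ → E3) (ξ : Direction) : Set ℝ :=
  {s | ∃ q ∈ crossings γ ξ, s = q.1 ∨ s = q.2}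

/-- The number of passages before the parameter `s`. -/
def passageIndex (γ : ℝ → E3) (ξ : Direction) (s : ℝ) : ℕ :=
  {u | u ∈ passages γ ξ ∧ u < s}.ncard

/-- The sign of the crossing at the parameters `s`, `t`. With respect to a viewer towards whom `ξ`
points, the sign is that of `(o, u, ξ)`, where `o` and `u` are the tangents of the over- and the
understrand. As `γ s - γ t` is a positive multiple of `ξ` if the strand at `s` is the upper one and
a negative multiple otherwise, this is the sign of `(γ' s, γ' t, γ s - γ t)` in both cases. -/
def crossingSign (γ : ℝ → E3) (s t : ℝ) : SignType :=
  SignType.sign (tripleProduct (deriv γ s) (deriv γ t) (γ s - γ t))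

/-- The tangent vector of `γ` on the left of the parameter `t`. -/
def leftTangent (γ : ℝ → E3) (t : ℝ) : E3 := derivWithin γ (Iic t) t

/-- The tangent vector of `γ` on the right of the parameter `t`. -/
def rightTangent (γ : ℝ → E3) (t : ℝ) : E3 := derivWithin γ (Ici t) t

/-- The projection of `γ` in the direction `ξ` is generic: it is (piecewise) immersed, without
cusps, and its singularities are finitely many transversal double points, none of which is an
end point or a corner. (`SameRay ℝ 0 v` holds, so `immersed` says that the one-sided
tangents of the projection do not vanish and are not antiparallel.) -/
structure IsGenericProjection (γ : ℝ → E3) (ξ : Direction) : Prop where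
  finite : (crossings γ ξ).Finite
  immersed_zero : projectAlong ξ (rightTangent γ 0) ≠ 0
  immersed_one : projectAlong ξ (leftTangent γ 1) ≠ 0
  immersed : ∀ t ∈ Ioo (0 : ℝ) 1,
    ¬ SameRay ℝ (projectAlong ξ (leftTangent γ t)) (-projectAlong ξ (rightTangent γ t))
  interior : ∀ q ∈ crossings γ ξ, 0 < q.1 ∧ q.2 < 1
  smooth : ∀ q ∈ crossings γ ξ, DifferentiableAt ℝ γ q.1 ∧ DifferentiableAt ℝ γ q.2
  transversal : ∀ q ∈ crossings γ ξ, tripleProduct (deriv γ q.1) (deriv γ q.2) ξ ≠ 0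
  double : ∀ q ∈ crossings γ ξ, ∀ r ∈ crossings γ ξ,
    (q.1 = r.1 ∨ q.1 = r.2 ∨ q.2 = r.1 ∨ q.2 = r.2) → q = r

open Classical in
/-- The diagram of the projection of `γ` in the direction `ξ`; the value is meaningful if this
projection is generic. -/
def projectionDiagram (γ : ℝ → E3) (ξ : Direction) : GaussDiagram :=
  if h : (crossings γ ξ).Finite then
    h.toFinset.image fun q =>
      ⟨passageIndex γ ξ q.1, passageIndex γ ξ q.2, crossingSign γ q.1 q.2⟩
  else ∅

/-- The coefficient of `A ^ k` in the normalized bracket polynomial of the projection. -/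
def projectionCoeff (γ : ℝ → E3) (k : ℤ) (ξ : Direction) : ℝ :=
  (projectionDiagram γ ξ).normalized.coeff k

/-- The normalized bracket polynomial
`(1 / 4π) ∫_{ξ ∈ S²} (-A³) ^ (-wr(γ_ξ)) ⟨γ_ξ⟩ dS` of the curve `γ`, given by its coefficients:
`normalizedBracket γ k` is the coefficient of `A ^ k`. -/
def normalizedBracket (γ : ℝ → E3) (k : ℤ) : ℝ :=
  1 / (4 * Real.pi) * ∫ ξ, projectionCoeff γ k ξ ∂sphereArea

/-- The average is well defined, and it is a Laurent polynomial that involves only the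
powers `A ^ k` with `-m ≤ k ≤ m`. -/
structure HasNormalizedBracket (γ : ℝ → E3) (m : ℕ) : Prop where
  generic : ∀ᵐ ξ ∂sphereArea, IsGenericProjection γ ξ
  integrable : ∀ k, Integrable (projectionCoeff γ k) sphereArea
  degree_le : ∀ k : ℤ, (m : ℤ) < |k| → normalizedBracket γ k = 0

/-- The normalized bracket polynomial as a point of the space of Laurent polynomials
`∑_{|k| ≤ m} a_k A ^ k` with the Euclidean norm of the coefficients. -/
def bracketVector (m : ℕ) (γ : ℝ → E3) : EuclideanSpace ℝ (Finset.Icc (-(m : ℤ)) (m : ℤ)) :=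
  WithLp.toLp 2 fun k => normalizedBracket γ k

/-! Polygonal chains. -/

/-- The polygonal curve with vertices `p 0, …, p n`: it runs through the edge from `p i` to
`p (i + 1)` with constant velocity for `i / n ≤ t ≤ (i + 1) / n`. -/
def polygonalCurve {n : ℕ} (p : Fin (n + 1) → E3) (t : ℝ) : E3 :=
  p 0 + ∑ i : Fin n, max 0 (min 1 (n * t - i)) • (p i.succ - p i.castSucc)

/-- The configuration space of open polygonal chains with `n` edges, in the
coordinates of the vertices: the chains without self-intersections (so that, in particular, the
two end points are distinct). -/
abbrev OpenPolygonalChain (n : ℕ) :=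
  {p : Fin (n + 1) → E3 // InjOn (polygonalCurve p) (Icc 0 1)}

/-! General curves. -/

/-- `γ` parametrizes a simple open piecewise `C¹` curve (regular, without cusps). -/
structure IsSimpleOpenCurve (γ : ℝ → E3) : Prop where
  injective : InjOn γ (Icc 0 1)
  piecewise : ∃ B : Finset ℝ, ∀ a b : ℝ, 0 ≤ a → a < b → b ≤ 1 →
    Disjoint (Ioo a b) (B : Set ℝ) → ContDiffOn ℝ 1 γ (Icc a b)
  regular_zero : rightTangent γ 0 ≠ 0
  regular_one : leftTangent γ 1 ≠ 0
  regular : ∀ t ∈ Ioo (0 : ℝ) 1, ¬ SameRay ℝ (leftTangent γ t) (-rightTangent γ t)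

/-- The simple open curves for which almost every projection is generic and has at most `M`
crossings. -/
structure IsTameOpenCurve (M : ℕ) (γ : ℝ → E3) : Prop extends IsSimpleOpenCurve γ where
  generic : ∀ᵐ ξ ∂sphereArea, IsGenericProjection γ ξ ∧ (crossings γ ξ).ncard ≤ M

/-- `γ` and `η` are `δ`-close together with their (one-sided) tangent vectors: both the
difference `γ - η` and its Lipschitz constant on `[0, 1]` are at most `δ`. -/
def IsC1Close (δ : ℝ) (γ η : ℝ → E3) : Prop :=
  (∀ t ∈ Icc (0 : ℝ) 1, ‖γ t - η t‖ ≤ δ) ∧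
    ∀ s ∈ Icc (0 : ℝ) 1, ∀ t ∈ Icc (0 : ℝ) 1,
      ‖(γ s - η s) - (γ t - η t)‖ ≤ δ * |s - t|

end

section

open Filter Topology

/-! ### One-sided strict differentiability -/

/-! The Gauss diagram is a discrete invariant: among generic pairs (curve, direction) it is locally
constant, the curves being compared in the `C¹` sense (`eventually_projectionDiagram_eq`). Only
finitely many diagrams have at most `M` crossings, so degrees and coefficients of their normalized
brackets are uniformly bounded. Each coefficient is therefore a bounded function of the direction
that is locally constant on a conull set, hence integrable. If curves `η n` tend to `γ`, then in
almost every direction the diagrams of `η n` eventually equal that of `γ`, and dominated convergence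
yields convergence of the averages.

For local constancy, crossings are the solutions of `γ s - γ t = l • ξ` with `s < t`. Away from the
diagonal and from the crossings, continuity excludes new solutions. Near the diagonal, the projected
curve moves strictly forward in some direction `w` orthogonal to `ξ`, because its one-sided tangents
neither vanish nor are antiparallel; this survives `C¹`-small changes
(`eventually_notMem_crossings_diagonal`). Compactness of the parameter triangle joins these
estimates. Near a crossing, transversality makes the linearized equation invertible, and a
Lipschitz-small perturbation of it keeps exactly one solution (`exists_nhds_crossing_stable`), whose
sign persists. As passages move little compared with their distances, their order persists too.

Polygonal chains are a special case. Directions with a non-generic projection lie in finitely many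
planes or are directions of lines meeting three edges, a two-parameter family of vectors in space;
both are null (`ae_isRegularDirection`). In the other directions two edges cross at most once, which
gives the bound `n * n`, and the curve is Lipschitz in its vertices for the `C¹`-distance
(`isC1Close_polygonalCurve`). -/

theorem eventually_norm_sub_sub_smul_derivWithin_le {γ : ℝ → E3} {a b t₀ c : ℝ} (hab : a < b)
    (h : ContDiffOn ℝ 1 γ (Icc a b)) (ht : t₀ ∈ Icc a b) (hc : 0 < c) :
    ∀ᶠ q : ℝ × ℝ in 𝓝 (t₀, t₀), q.1 ∈ Icc a b → q.2 ∈ Icc a b →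
      ‖γ q.2 - γ q.1 - (q.2 - q.1) • derivWithin γ (Icc a b) t₀‖ ≤ c * |q.2 - q.1| := by
  have hu := uniqueDiffOn_Icc hab
  have hcont := h.continuousOn_derivWithin hu le_rfl t₀ ht
  rw [ContinuousWithinAt, Metric.tendsto_nhdsWithin_nhds] at hcont
  obtain ⟨ε, hε, H⟩ := hcont c hc
  filter_upwards [Metric.ball_mem_nhds (t₀, t₀) hε] with q hq h1 h2
  rw [Metric.mem_ball, Prod.dist_eq, max_lt_iff] at hq
  -- Mean value inequality for `γ` minus its linear part at `t₀`, on an interval where the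
  -- derivative stays within `c` of its value at `t₀`.
  have key := (((convex_Icc a b).inter (convex_ball t₀ ε))).norm_image_sub_le_of_norm_hasDerivWithin_le
    (f := fun t => γ t - t • derivWithin γ (Icc a b) t₀)
    (f' := fun t => derivWithin γ (Icc a b) t - derivWithin γ (Icc a b) t₀) (C := c)
    (x := q.1) (y := q.2) ?_ ?_ ⟨h1, hq.1⟩ ⟨h2, hq.2⟩
  · rw [Real.norm_eq_abs] at key
    convert! key using 2
    simp only [sub_smul]; abel
  · intro x hx
    have h3 : HasDerivWithinAt γ (derivWithin γ (Icc a b) x) (Icc a b) x :=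
      ((h.differentiableOn one_ne_zero) x hx.1).hasDerivWithinAt
    have h4 := (hasDerivWithinAt_id x (Icc a b)).smul_const (derivWithin γ (Icc a b) t₀)
    have := h3.sub h4
    simp only [one_smul] at this
    exact this.mono inter_subset_left
  · intro x hx
    have := H hx.1 hx.2
    rw [dist_eq_norm] at this
    exact this.le

theorem exists_Ioo_left_disjoint (B : Finset ℝ) {l t : ℝ} (h : l < t) :
    ∃ a, l ≤ a ∧ a < t ∧ Disjoint (Ioo a t) (B : Set ℝ) := by
  -- The point `t` may itself be a break point; only the others must be avoided.
  have h1 : ((B : Set ℝ) \ {t})ᶜ ∈ 𝓝 t :=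
    ((B.finite_toSet.subset sdiff_subset).isClosed.isOpen_compl).mem_nhds (by simp)
  obtain ⟨a, ha, hs⟩ := exists_Ioc_subset_of_mem_nhds' h1 h
  refine ⟨a, ha.1, ha.2, ?_⟩
  rw [Set.disjoint_left]
  intro x hx hB
  exact hs ⟨hx.1, hx.2.le⟩ ⟨hB, by simpa using hx.2.ne⟩

theorem exists_Ioo_right_disjoint (B : Finset ℝ) {u t : ℝ} (h : t < u) :
    ∃ b, t < b ∧ b ≤ u ∧ Disjoint (Ioo t b) (B : Set ℝ) := by
  have h1 : ((B : Set ℝ) \ {t})ᶜ ∈ 𝓝 t :=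
    ((B.finite_toSet.subset sdiff_subset).isClosed.isOpen_compl).mem_nhds (by simp)
  obtain ⟨b, hb, hs⟩ := exists_Ico_subset_of_mem_nhds' h1 h
  refine ⟨b, hb.1, hb.2, ?_⟩
  rw [Set.disjoint_left]
  intro x hx hB
  exact hs ⟨hx.1.le, hx.2⟩ ⟨hB, by simpa using hx.1.ne'⟩

namespace IsSimpleOpenCurve

variable {γ : ℝ → E3}

theorem exists_contDiffOn_left (h : IsSimpleOpenCurve γ) {t : ℝ} (ht : t ∈ Ioc (0 : ℝ) 1) :
    ∃ a, 0 ≤ a ∧ a < t ∧ ContDiffOn ℝ 1 γ (Icc a t) := by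
  obtain ⟨B, hB⟩ := h.piecewise
  obtain ⟨a, h0, h1, h2⟩ := exists_Ioo_left_disjoint B ht.1
  exact ⟨a, h0, h1, hB a t h0 h1 ht.2 h2⟩

theorem exists_contDiffOn_right (h : IsSimpleOpenCurve γ) {t : ℝ} (ht : t ∈ Ico (0 : ℝ) 1) :
    ∃ b, t < b ∧ b ≤ 1 ∧ ContDiffOn ℝ 1 γ (Icc t b) := by
  obtain ⟨B, hB⟩ := h.piecewise
  obtain ⟨b, h0, h1, h2⟩ := exists_Ioo_right_disjoint B ht.2
  exact ⟨b, h0, h1, hB t b ht.1 h0 h1 h2⟩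

theorem eventually_left (h : IsSimpleOpenCurve γ) {t : ℝ} (ht : t ∈ Ioc (0 : ℝ) 1) {c : ℝ}
    (hc : 0 < c) :
    ∀ᶠ q : ℝ × ℝ in 𝓝 (t, t), q.1 ≤ t → q.2 ≤ t →
      ‖γ q.2 - γ q.1 - (q.2 - q.1) • leftTangent γ t‖ ≤ c * |q.2 - q.1| := by
  obtain ⟨a, -, h1, h2⟩ := h.exists_contDiffOn_left ht
  have e : derivWithin γ (Icc a t) t = leftTangent γ t :=
    derivWithin_congr_set (nhdsWithin_eq_iff_eventuallyEq.1 (nhdsWithin_Icc_eq_nhdsLE h1))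
  filter_upwards [eventually_norm_sub_sub_smul_derivWithin_le h1 h2 ⟨h1.le, le_rfl⟩ hc,
    (prod_mem_nhds (Ioi_mem_nhds h1) (Ioi_mem_nhds h1))] with q hq hq' l1 l2
  rw [e] at hq
  exact hq ⟨(mem_Ioi.1 hq'.1).le, l1⟩ ⟨(mem_Ioi.1 hq'.2).le, l2⟩

theorem eventually_right (h : IsSimpleOpenCurve γ) {t : ℝ} (ht : t ∈ Ico (0 : ℝ) 1) {c : ℝ}
    (hc : 0 < c) :
    ∀ᶠ q : ℝ × ℝ in 𝓝 (t, t), t ≤ q.1 → t ≤ q.2 →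
      ‖γ q.2 - γ q.1 - (q.2 - q.1) • rightTangent γ t‖ ≤ c * |q.2 - q.1| := by
  obtain ⟨b, h1, -, h2⟩ := h.exists_contDiffOn_right ht
  have e : derivWithin γ (Icc t b) t = rightTangent γ t :=
    derivWithin_congr_set (nhdsWithin_eq_iff_eventuallyEq.1 (nhdsWithin_Icc_eq_nhdsGE h1))
  filter_upwards [eventually_norm_sub_sub_smul_derivWithin_le h1 h2 ⟨le_rfl, h1.le⟩ hc,
    (prod_mem_nhds (Iio_mem_nhds h1) (Iio_mem_nhds h1))] with q hq hq' l1 l2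
  rw [e] at hq
  exact hq ⟨l1, (mem_Iio.1 hq'.1).le⟩ ⟨l2, (mem_Iio.1 hq'.2).le⟩

/-- A chord is split at `t`; `x` and `y` are the parameter lengths before and after `t`. Since they
are nonnegative, a functional positive on both tangents is positive on their combination. -/
theorem eventually_left_right (h : IsSimpleOpenCurve γ) {t : ℝ} (ht : t ∈ Ioo (0 : ℝ) 1) {c : ℝ}
    (hc : 0 < c) :
    ∀ᶠ q : ℝ × ℝ in 𝓝 (t, t), q.1 ≤ q.2 → ∃ x y : ℝ, 0 ≤ x ∧ 0 ≤ y ∧ x + y = q.2 - q.1 ∧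
      ‖γ q.2 - γ q.1 - (x • leftTangent γ t + y • rightTangent γ t)‖ ≤ c * (q.2 - q.1) := by
  have hl := h.eventually_left ⟨ht.1, ht.2.le⟩ hc
  have hr := h.eventually_right ⟨ht.1.le, ht.2⟩ hc
  have hl' : ∀ᶠ q : ℝ × ℝ in 𝓝 (t, t), q.1 ≤ t →
      ‖γ t - γ q.1 - (t - q.1) • leftTangent γ t‖ ≤ c * |t - q.1| := by
    have : Tendsto (fun q : ℝ × ℝ => (q.1, t)) (𝓝 (t, t)) (𝓝 (t, t)) :=
      Continuous.tendsto' (by fun_prop) _ _ rfl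
    filter_upwards [this.eventually hl] with q hq l using hq l le_rfl
  have hr' : ∀ᶠ q : ℝ × ℝ in 𝓝 (t, t), t ≤ q.2 →
      ‖γ q.2 - γ t - (q.2 - t) • rightTangent γ t‖ ≤ c * |q.2 - t| := by
    have : Tendsto (fun q : ℝ × ℝ => (t, q.2)) (𝓝 (t, t)) (𝓝 (t, t)) :=
      Continuous.tendsto' (by fun_prop) _ _ rfl
    filter_upwards [this.eventually hr] with q hq l using hq le_rfl l
  filter_upwards [hl, hr, hl', hr'] with q h1 h2 h3 h4 hq
  rcases le_total q.2 t with a | a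
  · refine ⟨q.2 - q.1, 0, by linarith, le_rfl, by ring, ?_⟩
    have := h1 (hq.trans a) a
    rw [abs_of_nonneg (by linarith)] at this
    simpa using this
  rcases le_total t q.1 with b | b
  · refine ⟨0, q.2 - q.1, le_rfl, by linarith, by ring, ?_⟩
    have := h2 b a
    rw [abs_of_nonneg (by linarith)] at this
    simpa using this
  · refine ⟨t - q.1, q.2 - t, by linarith, by linarith, by ring, ?_⟩
    have k1 := h3 b
    have k2 := h4 a
    rw [abs_of_nonneg (by linarith)] at k1 k2
    calc _ = ‖(γ t - γ q.1 - (t - q.1) • leftTangent γ t) +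
          (γ q.2 - γ t - (q.2 - t) • rightTangent γ t)‖ := by congr 1; abel
      _ ≤ _ := norm_add_le _ _
      _ ≤ _ := by linarith

/-- Strict differentiability from both sides at every parameter of the curve, the one-sided
tangents of a generic projection being neither zero nor antiparallel. -/
theorem exists_tangents (h : IsSimpleOpenCurve γ) {t : ℝ} (ht : t ∈ Icc (0 : ℝ) 1) :
    ∃ L R : E3, (∀ ξ, IsGenericProjection γ ξ →
        ¬ SameRay ℝ (projectAlong ξ L) (-projectAlong ξ R)) ∧
      ∀ c : ℝ, 0 < c → ∀ᶠ q : ℝ × ℝ in 𝓝 (t, t), q.1 ∈ Icc (0 : ℝ) 1 → q.2 ∈ Icc (0 : ℝ) 1 →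
        q.1 ≤ q.2 → ∃ x y : ℝ, 0 ≤ x ∧ 0 ≤ y ∧ x + y = q.2 - q.1 ∧
        ‖γ q.2 - γ q.1 - (x • L + y • R)‖ ≤ c * (q.2 - q.1) := by
  rcases eq_or_lt_of_le ht.1 with rfl | h0
  -- At an end point the only tangent `v` plays both roles; `SameRay ℝ v (-v)` forces `v = 0`, so
  -- nonvanishing of its projection suffices.
  · refine ⟨rightTangent γ 0, rightTangent γ 0, fun ξ hξ => ?_, fun c hc => ?_⟩
    · exact fun hs => hξ.immersed_zero (eq_zero_of_sameRay_self_neg hs)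
    · filter_upwards [h.eventually_right ⟨le_rfl, one_pos⟩ hc] with q hq h1 h2 h3
      refine ⟨q.2 - q.1, 0, by linarith, le_rfl, by ring, ?_⟩
      have := hq h1.1 h2.1
      rw [abs_of_nonneg (by linarith)] at this
      simpa using this
  rcases eq_or_lt_of_le ht.2 with rfl | h1
  · refine ⟨leftTangent γ 1, leftTangent γ 1, fun ξ hξ => ?_, fun c hc => ?_⟩
    · exact fun hs => hξ.immersed_one (eq_zero_of_sameRay_self_neg hs)
    · filter_upwards [h.eventually_left ⟨one_pos, le_rfl⟩ hc] with q hq h1 h2 h3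
      refine ⟨q.2 - q.1, 0, by linarith, le_rfl, by ring, ?_⟩
      have := hq h1.2 h2.2
      rw [abs_of_nonneg (by linarith)] at this
      simpa using this
  · refine ⟨leftTangent γ t, rightTangent γ t, fun ξ hξ => hξ.immersed t ⟨h0, h1⟩,
      fun c hc => ?_⟩
    filter_upwards [h.eventually_left_right ⟨h0, h1⟩ hc] with q hq _ _ using hq

theorem continuousOn (h : IsSimpleOpenCurve γ) : ContinuousOn γ (Icc 0 1) := by
  intro t ht
  obtain ⟨L, R, -, H⟩ := h.exists_tangents ht
  rw [ContinuousWithinAt, tendsto_iff_norm_sub_tendsto_zero]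
  have h1 : ∀ᶠ s in 𝓝[Icc 0 1] t, ‖γ s - γ t‖ ≤ (1 + ‖L‖ + ‖R‖) * |s - t| := by
    have a1 : Tendsto (fun s : ℝ => (s, t)) (𝓝 t) (𝓝 (t, t)) :=
      Continuous.tendsto' (by fun_prop) _ _ rfl
    have a2 : Tendsto (fun s : ℝ => (t, s)) (𝓝 t) (𝓝 (t, t)) :=
      Continuous.tendsto' (by fun_prop) _ _ rfl
    have key : ∀ (v : E3) (x y d : ℝ), 0 ≤ x → 0 ≤ y → x + y = d →
        ‖v - (x • L + y • R)‖ ≤ 1 * d → ‖v‖ ≤ (1 + ‖L‖ + ‖R‖) * d := by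
      intro v x y d hx hy hd hv
      calc ‖v‖ = ‖(v - (x • L + y • R)) + (x • L + y • R)‖ := by congr 1; abel
        _ ≤ 1 * d + (x * ‖L‖ + y * ‖R‖) := by
            refine (norm_add_le _ _).trans (add_le_add hv ((norm_add_le _ _).trans ?_))
            rw [norm_smul, norm_smul, Real.norm_of_nonneg hx, Real.norm_of_nonneg hy]
        _ ≤ 1 * d + (d * ‖L‖ + d * ‖R‖) := by gcongr <;> linarith
        _ = _ := by ring
    filter_upwards [self_mem_nhdsWithin, (a1.mono_left nhdsWithin_le_nhds).eventually (H 1 one_pos),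
      (a2.mono_left nhdsWithin_le_nhds).eventually (H 1 one_pos)] with s hs h1 h2
    rcases le_total s t with l | l
    · obtain ⟨x, y, hx, hy, hxy, hv⟩ := h1 hs ht l
      rw [norm_sub_rev, abs_sub_comm, abs_of_nonneg (by linarith)]
      exact key _ x y _ hx hy hxy hv
    · obtain ⟨x, y, hx, hy, hxy, hv⟩ := h2 ht hs l
      rw [abs_of_nonneg (by linarith)]
      exact key _ x y _ hx hy hxy hv
  refine squeeze_zero' (Eventually.of_forall fun _ => norm_nonneg _) h1 ?_
  have : Tendsto (fun s : ℝ => (1 + ‖L‖ + ‖R‖) * |s - t|) (𝓝 t) (𝓝 0) :=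
    Continuous.tendsto' (by fun_prop) _ _ (by simp)
  exact this.mono_left nhdsWithin_le_nhds

theorem eventually_deriv (h : IsSimpleOpenCurve γ) {t : ℝ} (ht : t ∈ Ioo (0 : ℝ) 1)
    (hd : DifferentiableAt ℝ γ t) {c : ℝ} (hc : 0 < c) :
    ∀ᶠ q : ℝ × ℝ in 𝓝 (t, t),
      ‖γ q.2 - γ q.1 - (q.2 - q.1) • deriv γ t‖ ≤ c * |q.2 - q.1| := by
  have hL : leftTangent γ t = deriv γ t := hd.derivWithin (uniqueDiffWithinAt_Iic t)
  have hR : rightTangent γ t = deriv γ t := hd.derivWithin (uniqueDiffWithinAt_Ici t)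
  have H := h.eventually_left_right ht hc
  have H' := (continuous_swap.tendsto (t, t)).eventually H
  have key : ∀ q : ℝ × ℝ, q.1 ≤ q.2 → (∃ x y : ℝ, 0 ≤ x ∧ 0 ≤ y ∧ x + y = q.2 - q.1 ∧
      ‖γ q.2 - γ q.1 - (x • leftTangent γ t + y • rightTangent γ t)‖ ≤ c * (q.2 - q.1)) →
      ‖γ q.2 - γ q.1 - (q.2 - q.1) • deriv γ t‖ ≤ c * |q.2 - q.1| := by
    rintro q hq ⟨x, y, -, -, hxy, hv⟩
    rw [hL, hR, ← add_smul, hxy] at hv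
    rwa [abs_of_nonneg (by linarith)]
  filter_upwards [H, H'] with q h1 h2
  rcases le_total q.1 q.2 with l | l
  · exact key q l (h1 l)
  · have := key q.swap l (h2 l)
    simp only [Prod.fst_swap, Prod.snd_swap] at this
    rw [abs_sub_comm, ← norm_neg]
    convert! this using 2
    simp only [sub_smul]; abel

end IsSimpleOpenCurve

/-! ### Scalar triple products and projections -/

theorem tripleProduct_eq (u v w : E3) :
    tripleProduct u v w = u 0 * v 1 * w 2 - u 0 * v 2 * w 1 - u 1 * v 0 * w 2 + u 1 * v 2 * w 0
      + u 2 * v 0 * w 1 - u 2 * v 1 * w 0 := by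
  simp [tripleProduct, Matrix.det_fin_three]

theorem continuous_tripleProduct :
    Continuous fun z : E3 × E3 × E3 => tripleProduct z.1 z.2.1 z.2.2 := by
  simp only [tripleProduct_eq]
  fun_prop

theorem tripleProduct_smul_smul_smul (a b c : ℝ) (u v w : E3) :
    tripleProduct (a • u) (b • v) (c • w) = a * b * c * tripleProduct u v w := by
  simp only [tripleProduct_eq, PiLp.smul_apply, smul_eq_mul]
  ring

/-- Cramer's rule: putting the vanishing combination into one slot multiplies the determinant by the
corresponding coefficient. -/
theorem eq_zero_of_tripleProduct_ne_zero {u v w : E3} (h : tripleProduct u v w ≠ 0) {x y z : ℝ}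
    (e : x • u + y • v + z • w = 0) : x = 0 ∧ y = 0 ∧ z = 0 := by
  have h1 : x * tripleProduct u v w = tripleProduct (x • u + y • v + z • w) v w := by
    simp only [tripleProduct_eq, PiLp.smul_apply, smul_eq_mul, PiLp.add_apply]; ring
  have h2 : y * tripleProduct u v w = tripleProduct u (x • u + y • v + z • w) w := by
    simp only [tripleProduct_eq, PiLp.smul_apply, smul_eq_mul, PiLp.add_apply]; ring
  have h3 : z * tripleProduct u v w = tripleProduct u v (x • u + y • v + z • w) := by
    simp only [tripleProduct_eq, PiLp.smul_apply, smul_eq_mul, PiLp.add_apply]; ring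
  have z1 (a b : E3) : tripleProduct 0 a b = 0 := by simp [tripleProduct_eq]
  have z2 (a b : E3) : tripleProduct a 0 b = 0 := by simp [tripleProduct_eq]
  have z3 (a b : E3) : tripleProduct a b 0 = 0 := by simp [tripleProduct_eq]
  rw [e] at h1 h2 h3
  rw [z1, mul_eq_zero] at h1
  rw [z2, mul_eq_zero] at h2
  rw [z3, mul_eq_zero] at h3
  exact ⟨h1.resolve_right h, h2.resolve_right h, h3.resolve_right h⟩

theorem norm_direction (ξ : Direction) : ‖(ξ : E3)‖ = 1 := by simp

theorem projectAlong_sub (ξ : Direction) (x y : E3) :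
    projectAlong ξ (x - y) = projectAlong ξ x - projectAlong ξ y := by
  simp only [projectAlong, inner_sub_right, sub_smul]; abel

theorem projectAlong_add (ξ : Direction) (x y : E3) :
    projectAlong ξ (x + y) = projectAlong ξ x + projectAlong ξ y := by
  simp only [projectAlong, inner_add_right, add_smul]; abel

theorem projectAlong_smul (ξ : Direction) (c : ℝ) (x : E3) :
    projectAlong ξ (c • x) = c • projectAlong ξ x := by
  simp only [projectAlong, inner_smul_right, smul_sub, mul_smul]

theorem projectAlong_eq_zero_iff {ξ : Direction} {x : E3} :
    projectAlong ξ x = 0 ↔ ∃ l : ℝ, x = l • (ξ : E3) := by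
  constructor
  · intro h; exact ⟨_, sub_eq_zero.1 h⟩
  · rintro ⟨l, rfl⟩
    simp [projectAlong, inner_smul_right]

theorem projectAlong_eq_iff {ξ : Direction} {x y : E3} :
    projectAlong ξ x = projectAlong ξ y ↔ ∃ l : ℝ, x - y = l • (ξ : E3) := by
  rw [← sub_eq_zero, ← projectAlong_sub, projectAlong_eq_zero_iff]

theorem inner_projectAlong_self (ξ : Direction) (x : E3) : inner ℝ (ξ : E3) (projectAlong ξ x) = 0 := by
  simp [projectAlong, inner_sub_right, inner_smul_right]

theorem inner_projectAlong (ξ : Direction) (x y : E3) :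
    inner ℝ (projectAlong ξ x) y = inner ℝ (projectAlong ξ x) (projectAlong ξ y) := by
  have := inner_projectAlong_self ξ x
  rw [real_inner_comm] at this
  conv_rhs => rw [projectAlong.eq_def ξ y, inner_sub_right, inner_smul_right, this]
  simp

/-- Two vectors whose projections are neither zero nor antiparallel have a common direction of
growth that is orthogonal to the direction of the projection. -/
theorem exists_inner_pos {ξ : Direction} {L R : E3}
    (h : ¬ SameRay ℝ (projectAlong ξ L) (-projectAlong ξ R)) :
    ∃ w : E3, inner ℝ w (ξ : E3) = 0 ∧ 0 < inner ℝ w L ∧ 0 < inner ℝ w R := by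
  set l := projectAlong ξ L with hl
  set r := projectAlong ξ R with hr
  have hl0 : 0 < ‖l‖ := norm_pos_iff.2 fun e => h (by rw [e]; exact SameRay.zero_left _)
  have hr0 : 0 < ‖r‖ := norm_pos_iff.2 fun e => h (by rw [e, neg_zero]; exact SameRay.zero_right _)
  have hlt : inner ℝ l (-r) < ‖l‖ * ‖-r‖ := by
    refine lt_of_le_of_ne (real_inner_le_norm _ _) fun e => h ?_
    rw [sameRay_iff_norm_smul_eq]
    exact (inner_eq_norm_mul_iff_real.1 e).symm
  rw [inner_neg_right, norm_neg] at hlt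
  -- A vector along the bisector of `l` and `r`. Its product with `l` is `‖l‖ * (‖l‖ * ‖r‖ + ⟪l,
  -- r⟫)`, positive by strict Cauchy–Schwarz for `l` and `-r`; likewise for `r`.
  refine ⟨‖r‖ • l + ‖l‖ • r, ?_, ?_, ?_⟩
  · rw [real_inner_comm, inner_add_right, inner_smul_right, inner_smul_right, hl, hr,
      inner_projectAlong_self, inner_projectAlong_self]
    simp
  · rw [inner_add_left, inner_smul_left, inner_smul_left, hl, hr, inner_projectAlong,
      inner_projectAlong ξ R, ← hl, ← hr, real_inner_self_eq_norm_sq, real_inner_comm]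
    simp only [RCLike.conj_to_real]
    nlinarith
  · rw [inner_add_left, inner_smul_left, inner_smul_left, hl, hr, inner_projectAlong,
      inner_projectAlong ξ R, ← hl, ← hr, real_inner_self_eq_norm_sq]
    simp only [RCLike.conj_to_real]
    nlinarith

/-! ### The filter of `C¹`-neighbourhoods -/

theorem IsC1Close.mono {δ δ' : ℝ} (h : δ ≤ δ') {γ η : ℝ → E3} (hc : IsC1Close δ γ η) :
    IsC1Close δ' γ η :=
  ⟨fun t ht => (hc.1 t ht).trans h, fun s hs t ht =>
    (hc.2 s hs t ht).trans (mul_le_mul_of_nonneg_right h (abs_nonneg _))⟩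

theorem IsC1Close.refl {δ : ℝ} (h : 0 ≤ δ) (γ : ℝ → E3) : IsC1Close δ γ γ :=
  ⟨fun t _ => by simpa using h, fun s _ t _ => by simpa using mul_nonneg h (abs_nonneg _)⟩

/-- The filter of `C¹`-neighbourhoods of the curve `γ`. -/
def c1Nhds (γ : ℝ → E3) : Filter (ℝ → E3) := ⨅ (δ : ℝ) (_ : 0 < δ), 𝓟 {η | IsC1Close δ γ η}

theorem hasBasis_c1Nhds (γ : ℝ → E3) :
    (c1Nhds γ).HasBasis (fun δ : ℝ => 0 < δ) fun δ => {η | IsC1Close δ γ η} := by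
  refine hasBasis_biInf_principal' ?_ ⟨1, one_pos⟩
  intro i hi j hj
  exact ⟨min i j, lt_min hi hj, fun η h => h.mono (min_le_left _ _),
    fun η h => h.mono (min_le_right _ _)⟩

theorem eventually_isC1Close (γ : ℝ → E3) {δ : ℝ} (hδ : 0 < δ) :
    ∀ᶠ η in c1Nhds γ, IsC1Close δ γ η :=
  (hasBasis_c1Nhds γ).mem_of_mem hδ

theorem pure_le_c1Nhds (γ : ℝ → E3) : pure γ ≤ c1Nhds γ := by
  rw [(hasBasis_c1Nhds γ).ge_iff]
  intro δ hδ
  exact IsC1Close.refl hδ.le γ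

theorem tendsto_eval_c1Nhds {γ : ℝ → E3} (h : ContinuousOn γ (Icc 0 1)) {t : ℝ}
    (ht : t ∈ Icc (0 : ℝ) 1) :
    Tendsto (fun z : (ℝ → E3) × ℝ => z.1 z.2) (c1Nhds γ ×ˢ 𝓝[Icc 0 1] t) (𝓝 (γ t)) := by
  rw [Metric.tendsto_nhds]
  intro ε hε
  have h1 := (Metric.tendsto_nhds.1 (h t ht)) (ε / 2) (half_pos hε)
  filter_upwards [(eventually_isC1Close γ (half_pos (half_pos hε))).prod_mk
    (h1.and self_mem_nhdsWithin)] with z hz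
  obtain ⟨z1, z2, z3⟩ := hz
  have := z1.1 _ z3
  rw [← dist_eq_norm, dist_comm] at this
  linarith [dist_triangle (z.1 z.2) (γ z.2) (γ t)]

/-! ### Crossings of nearby projections -/

/-- The neighbourhoods of a curve together with a direction. -/
abbrev viewNhds (γ : ℝ → E3) (ξ : Direction) : Filter ((ℝ → E3) × Direction) := c1Nhds γ ×ˢ 𝓝 ξ

theorem mem_crossings_iff {γ : ℝ → E3} {ξ : Direction} {q : ℝ × ℝ} :
    q ∈ crossings γ ξ ↔
      0 ≤ q.1 ∧ q.1 < q.2 ∧ q.2 ≤ 1 ∧ ∃ l : ℝ, γ q.1 - γ q.2 = l • (ξ : E3) := by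
  rw [← projectAlong_eq_iff]; rfl

theorem eventually_notMem_crossings_of_ne {γ : ℝ → E3} {ξ : Direction}
    (h : ContinuousOn γ (Icc 0 1)) {q : ℝ × ℝ} (h1 : q.1 ∈ Icc (0 : ℝ) 1)
    (h2 : q.2 ∈ Icc (0 : ℝ) 1) (hq : projectAlong ξ (γ q.1) ≠ projectAlong ξ (γ q.2)) :
    ∀ᶠ z in viewNhds γ ξ ×ˢ 𝓝 q, z.2 ∉ crossings z.1.1 z.1.2 := by
  have hc : Continuous fun z : E3 × E3 × E3 =>
      ((z.2.1 - z.2.2) - inner ℝ z.1 (z.2.1 - z.2.2) • z.1) := by fun_prop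
  have hE : Tendsto (fun z : ((ℝ → E3) × Direction) × (ℝ × ℝ) =>
      ((z.1.2 : E3), z.1.1 z.2.1, z.1.1 z.2.2))
      (viewNhds γ ξ ×ˢ 𝓝[Icc 0 1 ×ˢ Icc 0 1] q) (𝓝 ((ξ : E3), γ q.1, γ q.2)) := by
    have f1 : Tendsto (fun z : ((ℝ → E3) × Direction) × (ℝ × ℝ) => z.1.1)
      (viewNhds γ ξ ×ˢ 𝓝[Icc 0 1 ×ˢ Icc 0 1] q) (c1Nhds γ) := tendsto_fst.comp tendsto_fst
    have f2 : Tendsto (fun z : ((ℝ → E3) × Direction) × (ℝ × ℝ) => z.1.2)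
      (viewNhds γ ξ ×ˢ 𝓝[Icc 0 1 ×ˢ Icc 0 1] q) (𝓝 ξ) := tendsto_snd.comp tendsto_fst
    have f3 : Tendsto (fun z : ((ℝ → E3) × Direction) × (ℝ × ℝ) => z.2)
      (viewNhds γ ξ ×ˢ 𝓝[Icc 0 1 ×ˢ Icc 0 1] q) (𝓝[Icc 0 1] q.1 ×ˢ 𝓝[Icc 0 1] q.2) := by
      rw [← nhdsWithin_prod_eq]; exact tendsto_snd
    refine (continuous_subtype_val.tendsto ξ |>.comp f2).prodMk_nhds (Tendsto.prodMk_nhds ?_ ?_)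
    · exact (tendsto_eval_c1Nhds h h1).comp (f1.prodMk (tendsto_fst.comp f3))
    · exact (tendsto_eval_c1Nhds h h2).comp (f1.prodMk (tendsto_snd.comp f3))
  have hne := (hc.tendsto _).comp hE |>.eventually ((isOpen_compl_singleton (x := (0 : E3))).mem_nhds (by
    have := sub_ne_zero.2 hq
    rwa [← projectAlong_sub] at this))
  have hne' : ∀ᶠ z in viewNhds γ ξ ×ˢ 𝓝 q, z.2 ∈ Icc (0 : ℝ) 1 ×ˢ Icc (0 : ℝ) 1 →
      projectAlong z.1.2 (z.1.1 z.2.1 - z.1.1 z.2.2) ≠ 0 := by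
    have e : viewNhds γ ξ ×ˢ 𝓝[Icc 0 1 ×ˢ Icc 0 1] q
        = (viewNhds γ ξ ×ˢ 𝓝 q) ⊓ 𝓟 (Prod.snd ⁻¹' (Icc (0 : ℝ) 1 ×ˢ Icc (0 : ℝ) 1)) := by
      rw [nhdsWithin, Filter.prod_eq_inf (viewNhds γ ξ) (𝓝 q ⊓ _), comap_inf, comap_principal,
        Filter.prod_eq_inf (viewNhds γ ξ) (𝓝 q), inf_assoc]
    rw [e, eventually_inf_principal] at hne
    exact hne
  filter_upwards [hne'] with z hz hcr
  refine hz ⟨⟨hcr.1, hcr.2.1.le.trans hcr.2.2.1⟩, ⟨hcr.1.trans hcr.2.1.le, hcr.2.2.1⟩⟩ ?_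
  rw [projectAlong_sub, sub_eq_zero]
  exact hcr.2.2.2

/-- A short chord of a nearby curve advances along `w` at a rate close to at least `m`. A chord
parallel to a direction near `ξ` has almost no component along `w`, since `w` is orthogonal to `ξ`.
-/
theorem eventually_notMem_crossings_diagonal {γ : ℝ → E3} {ξ : Direction}
    (h : IsSimpleOpenCurve γ) (hξ : IsGenericProjection γ ξ) {t : ℝ} (ht : t ∈ Icc (0 : ℝ) 1) :
    ∀ᶠ z in viewNhds γ ξ ×ˢ 𝓝 (t, t), z.2 ∉ crossings z.1.1 z.1.2 := by
  obtain ⟨L, R, hLR, H⟩ := h.exists_tangents ht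
  obtain ⟨w, hw, hwL, hwR⟩ := exists_inner_pos (hLR ξ hξ)
  set m := min (inner ℝ w L) (inner ℝ w R) with hm
  have hm0 : 0 < m := lt_min hwL hwR
  set K := ‖L‖ + ‖R‖ with hK
  have hK0 : 0 ≤ K := by positivity
  -- The summand `2` pays for the error of the chord (one `δ` from differentiability of `γ`, one
  -- from the `C¹`-distance), the summand `K + 2` for the length of the chord times the tilt of the
  -- direction.
  obtain ⟨δ, hδ0, hδ1, hδ⟩ : ∃ δ : ℝ, 0 < δ ∧ δ ≤ 1 ∧ ‖w‖ * (2 + (K + 2)) * δ < m := by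
    have h0 : Tendsto (fun δ : ℝ => ‖w‖ * (2 + (K + 2)) * δ) (𝓝[>] 0) (𝓝 0) :=
      (Continuous.tendsto' (by fun_prop) _ _ (by simp)).mono_left nhdsWithin_le_nhds
    have h1 : ∀ᶠ δ : ℝ in 𝓝[>] 0, δ ≤ 1 :=
      nhdsWithin_le_nhds (Iic_mem_nhds one_pos)
    obtain ⟨δ, a, b, c⟩ := ((eventually_mem_nhdsWithin (s := Ioi (0 : ℝ))).and
      (h1.and (h0.eventually_lt_const hm0))).exists
    exact ⟨δ, a, b, c⟩
  have hball : ∀ᶠ ξ' : Direction in 𝓝 ξ, ‖(ξ' : E3) - ξ‖ < δ := by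
    filter_upwards [Metric.ball_mem_nhds ξ hδ0] with ξ' h'
    rwa [Metric.mem_ball, Subtype.dist_eq, dist_eq_norm] at h'
  filter_upwards [((eventually_isC1Close γ hδ0).prod_mk hball).prod_mk (H δ hδ0)] with z hz hcr
  obtain ⟨⟨z1, z2⟩, z3⟩ := hz
  rw [mem_crossings_iff] at hcr
  obtain ⟨c1, c2, c3, l, hl⟩ := hcr
  have m1 : z.2.1 ∈ Icc (0 : ℝ) 1 := ⟨c1, c2.le.trans c3⟩
  have m2 : z.2.2 ∈ Icc (0 : ℝ) 1 := ⟨c1.trans c2.le, c3⟩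
  obtain ⟨x, y, hx, hy, hxy, hv⟩ := z3 m1 m2 c2.le
  have hd : 0 < z.2.2 - z.2.1 := by linarith
  set d := z.2.2 - z.2.1 with hdd
  have hη := z1.2 _ m2 _ m1
  rw [← hdd, abs_of_pos hd] at hη
  set e := z.1.1 z.2.2 - z.1.1 z.2.1 - (x • L + y • R) with he
  have hen : ‖e‖ ≤ 2 * δ * d := by
    calc ‖e‖ = ‖(γ z.2.2 - γ z.2.1 - (x • L + y • R))
          - (γ z.2.2 - z.1.1 z.2.2 - (γ z.2.1 - z.1.1 z.2.1))‖ := by rw [he]; congr 1; abel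
      _ ≤ _ := norm_sub_le _ _
      _ ≤ _ := by linarith
  have hηe : z.1.1 z.2.2 - z.1.1 z.2.1 = e + (x • L + y • R) := by rw [he]; abel
  have hηl : z.1.1 z.2.2 - z.1.1 z.2.1 = (-l) • (z.1.2 : E3) := by
    rw [neg_smul, ← hl]; abel
  have hlb : |l| ≤ (K + 2) * d := by
    have : |l| = ‖z.1.1 z.2.2 - z.1.1 z.2.1‖ := by
      rw [hηl, norm_smul, norm_direction]; simp
    rw [this, hηe]
    refine (norm_add_le _ _).trans ?_
    have : ‖x • L + y • R‖ ≤ d * ‖L‖ + d * ‖R‖ := by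
      refine (norm_add_le _ _).trans ?_
      rw [norm_smul, norm_smul, Real.norm_of_nonneg hx, Real.norm_of_nonneg hy]
      gcongr <;> linarith
    nlinarith
  have i1 : inner ℝ w (z.1.1 z.2.2 - z.1.1 z.2.1) ≤ ‖w‖ * (δ * ((K + 2) * d)) := by
    have : z.1.1 z.2.2 - z.1.1 z.2.1 = (-l) • ((z.1.2 : E3) - ξ) + (-l) • (ξ : E3) := by
      rw [hηl, ← smul_add]; congr 1; abel
    rw [this, inner_add_right, inner_smul_right _ (ξ : E3), hw, mul_zero, add_zero]
    refine (real_inner_le_norm _ _).trans ?_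
    rw [norm_smul, norm_neg, Real.norm_eq_abs, mul_comm |l|]
    gcongr
  have i2 : m * d - ‖w‖ * (2 * δ * d) ≤ inner ℝ w (z.1.1 z.2.2 - z.1.1 z.2.1) := by
    rw [hηe, inner_add_right, inner_add_right, inner_smul_right, inner_smul_right]
    have a1 : x * m ≤ x * inner ℝ w L := mul_le_mul_of_nonneg_left (min_le_left _ _) hx
    have a2 : y * m ≤ y * inner ℝ w R := mul_le_mul_of_nonneg_left (min_le_right _ _) hy
    have a3 : -(‖w‖ * (2 * δ * d)) ≤ inner ℝ w e := by
      have := (abs_le.1 (abs_real_inner_le_norm w e)).1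
      have := mul_le_mul_of_nonneg_left hen (norm_nonneg w)
      linarith
    have a4 : m * d = x * m + y * m := by rw [← add_mul, hxy]; ring
    linarith
  have : m * d ≤ (‖w‖ * (2 + (K + 2)) * δ) * d := by linarith
  exact absurd (le_of_mul_le_mul_right this hd) (not_le.2 hδ)

/-- All crossings of nearby projections are near the crossings of a generic projection. -/
theorem eventually_crossings_subset {γ : ℝ → E3} {ξ : Direction}
    (h : IsSimpleOpenCurve γ) (hξ : IsGenericProjection γ ξ) {V : Set (ℝ × ℝ)} (hV : IsOpen V)
    (hsub : crossings γ ξ ⊆ V) : ∀ᶠ z in viewNhds γ ξ, crossings z.1 z.2 ⊆ V := by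
  -- The diagonal, which `crossings` excludes, is included here to make the region compact.
  set K : Set (ℝ × ℝ) := {q | 0 ≤ q.1 ∧ q.1 ≤ q.2 ∧ q.2 ≤ 1} \ V with hK
  have hcl : IsClosed {q : ℝ × ℝ | 0 ≤ q.1 ∧ q.1 ≤ q.2 ∧ q.2 ≤ 1} :=
    (isClosed_le continuous_const continuous_fst).inter
      ((isClosed_le continuous_fst continuous_snd).inter
        (isClosed_le continuous_snd continuous_const))
  have hKc : IsCompact K := by
    refine IsCompact.diff ((isCompact_Icc (a := ((0 : ℝ), (0 : ℝ))) (b := (1, 1))).of_isClosed_subset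
      hcl ?_) hV
    rintro q ⟨a, b, c⟩
    exact ⟨⟨a, a.trans b⟩, ⟨b.trans c, c⟩⟩
  have key : ∀ q ∈ K, ∀ᶠ z in viewNhds γ ξ ×ˢ 𝓝 q, z.2 ∉ crossings z.1.1 z.1.2 := by
    rintro ⟨s, t⟩ ⟨⟨a, b, c⟩, hnV⟩
    rcases eq_or_lt_of_le b with e | l
    · dsimp only at e a b c
      subst e
      exact eventually_notMem_crossings_diagonal h hξ ⟨a, c⟩
    · refine eventually_notMem_crossings_of_ne h.continuousOn ⟨a, b.trans c⟩ ⟨a.trans b, c⟩ ?_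
      intro e
      exact hnV (hsub ⟨a, l, c, e⟩)
  have hs : ∀ᶠ z in viewNhds γ ξ, ∀ q ∈ K, q ∉ crossings z.1 z.2 := by
    refine hKc.induction_on (p := fun S => ∀ᶠ z in viewNhds γ ξ, ∀ q ∈ S, q ∉ crossings z.1 z.2)
      ?_ ?_ ?_ ?_
    · simp
    · intro s t hst ht
      filter_upwards [ht] with z hz q hq using hz q (hst hq)
    · intro s t hs ht
      filter_upwards [hs, ht] with z h1 h2 q hq using hq.elim (h1 q) (h2 q)
    · intro q hq
      obtain ⟨P, hP, Q, hQ, hPQ⟩ := eventually_prod_iff.1 (key q hq)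
      exact ⟨{x | Q x}, mem_nhdsWithin_of_mem_nhds hQ, by
        filter_upwards [hP] with z hz x hx using hPQ hz hx⟩
  filter_upwards [hs] with z hz q hq
  by_contra hqV
  exact hz q ⟨⟨hq.1, hq.2.1.le, hq.2.2.1⟩, hqV⟩ hq

/-! ### Linear approximation uniform over nearby curves -/

namespace IsSimpleOpenCurve

variable {γ : ℝ → E3}

/-- Half of `c` covers the nonlinearity of `γ`, half the `C¹`-distance. The neighbourhood `U` does
not depend on `η`. -/
theorem exists_nhds_norm_le (h : IsSimpleOpenCurve γ) {t : ℝ} (ht : t ∈ Ioo (0 : ℝ) 1)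
    (hd : DifferentiableAt ℝ γ t) {c : ℝ} (hc : 0 < c) :
    ∃ U ∈ 𝓝 t, ∀ᶠ η in c1Nhds γ, ∀ s ∈ U, ∀ s' ∈ U,
      ‖η s' - η s - (s' - s) • deriv γ t‖ ≤ c * |s' - s| := by
  have h1 := h.eventually_deriv ht hd (half_pos hc)
  rw [nhds_prod_eq] at h1
  obtain ⟨V, hV, H⟩ := mem_prod_self_iff.1 h1
  refine ⟨V ∩ Icc 0 1, inter_mem hV (Icc_mem_nhds ht.1 ht.2), ?_⟩
  filter_upwards [eventually_isC1Close γ (half_pos hc)] with η hη s hs s' hs'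
  have h2 := H (mk_mem_prod hs.1 hs'.1)
  have h3 := hη.2 s' hs'.2 s hs.2
  rw [mem_ofPred_eq] at h2
  calc _ = ‖(γ s' - γ s - (s' - s) • deriv γ t) - (γ s' - η s' - (γ s - η s))‖ := by
        congr 1; abel
    _ ≤ _ := norm_sub_le _ _
    _ ≤ _ := by linarith

/-- A nearby curve may have corners near `t`, hence the restriction to pairs where the derivative
exists. There the increment bound of `exists_nhds_norm_le` passes to the derivative. -/
theorem tendsto_deriv (h : IsSimpleOpenCurve γ) {t : ℝ} (ht : t ∈ Ioo (0 : ℝ) 1)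
    (hd : DifferentiableAt ℝ γ t) :
    Tendsto (fun z : (ℝ → E3) × ℝ => deriv z.1 z.2)
      ((c1Nhds γ ×ˢ 𝓝 t) ⊓ 𝓟 {z | DifferentiableAt ℝ z.1 z.2}) (𝓝 (deriv γ t)) := by
  rw [Metric.tendsto_nhds]
  intro ε hε
  obtain ⟨U, hU, H⟩ := h.exists_nhds_norm_le ht hd (half_pos hε)
  rw [eventually_inf_principal]
  have hU' : ∀ᶠ s in 𝓝 t, U ∈ 𝓝 s := eventually_mem_nhds_iff.2 hU
  filter_upwards [H.prod_mk hU'] with z hz hzd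
  obtain ⟨z1, z2⟩ := hz
  have hg := (hzd.hasDerivAt).sub ((hasDerivAt_id z.2).smul_const (deriv γ t))
  simp only [one_smul] at hg
  have := hg.le_of_lip' (half_pos hε).le (by
    filter_upwards [z2] with s hs
    have := z1 z.2 (mem_of_mem_nhds z2) s hs
    rw [Real.norm_eq_abs]
    convert! this using 2
    simp only [Pi.sub_apply, id, sub_smul]; abel)
  rw [dist_eq_norm]
  linarith

end IsSimpleOpenCurve

/-- The linear map `((a, b), l) ↦ a • u - b • v - l • w`. -/
def lineEquationMap (u v w : E3) : ((ℝ × ℝ) × ℝ) →L[ℝ] E3 :=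
  (((ContinuousLinearMap.fst ℝ ℝ ℝ).smulRight u - (ContinuousLinearMap.snd ℝ ℝ ℝ).smulRight v).comp
    (ContinuousLinearMap.fst ℝ (ℝ × ℝ) ℝ)) - (ContinuousLinearMap.snd ℝ (ℝ × ℝ) ℝ).smulRight w

theorem lineEquationMap_apply (u v w : E3) (x : (ℝ × ℝ) × ℝ) :
    lineEquationMap u v w x = x.1.1 • u - x.1.2 • v - x.2 • w := by
  simp [lineEquationMap]

theorem exists_continuousLinearEquiv_lineEquationMap {u v w : E3} (h : tripleProduct u v w ≠ 0) :
    ∃ e : ((ℝ × ℝ) × ℝ) ≃L[ℝ] E3, (e : ((ℝ × ℝ) × ℝ) →L[ℝ] E3) = lineEquationMap u v w := by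
  have hinj : Function.Injective (lineEquationMap u v w : ((ℝ × ℝ) × ℝ) →ₗ[ℝ] E3) := by
    rw [← LinearMap.ker_eq_bot, LinearMap.ker_eq_bot']
    rintro ⟨⟨a, b⟩, l⟩ hx
    rw [ContinuousLinearMap.coe_coe, lineEquationMap_apply] at hx
    obtain ⟨h1, h2, h3⟩ := eq_zero_of_tripleProduct_ne_zero h (x := a) (y := -b) (z := -l)
      (by rw [← hx]; simp only [neg_smul]; abel)
    simp only [neg_eq_zero] at h2 h3
    simp [h1, h2, h3]
  refine ⟨(LinearEquiv.ofInjectiveOfFinrankEq _ hinj (by simp)).toContinuousLinearEquiv, ?_⟩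
  ext x <;> rfl

/-- The equation `η s - η t - l • ξ = 0` of the crossings is, near a crossing of a generic
projection, a small perturbation of a linear one. -/
theorem exists_nhds_approximatesLinearOn {γ : ℝ → E3} {ξ : Direction} (h : IsSimpleOpenCurve γ)
    {q : ℝ × ℝ} (h1 : q.1 ∈ Ioo (0 : ℝ) 1) (h2 : q.2 ∈ Ioo (0 : ℝ) 1)
    (d1 : DifferentiableAt ℝ γ q.1) (d2 : DifferentiableAt ℝ γ q.2) {c : NNReal} (hc : 0 < c) :
    ∃ U ∈ 𝓝 q, ∀ᶠ z in viewNhds γ ξ, ApproximatesLinearOn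
      (fun x : (ℝ × ℝ) × ℝ => z.1 x.1.1 - z.1 x.1.2 - x.2 • (z.2 : E3))
      (lineEquationMap (deriv γ q.1) (deriv γ q.2) ξ) (U ×ˢ univ) c := by
  -- One third each for the two strands and for the change of the direction.
  have hc3 : (0 : ℝ) < c / 3 := by positivity
  obtain ⟨U, hU, HU⟩ := h.exists_nhds_norm_le h1 d1 hc3
  obtain ⟨V, hV, HV⟩ := h.exists_nhds_norm_le h2 d2 hc3
  refine ⟨U ×ˢ V, prod_mem_nhds hU hV, ?_⟩
  filter_upwards [(HU.and HV).prod_mk (Metric.ball_mem_nhds ξ hc3)] with z hz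
  obtain ⟨⟨z1, z2⟩, z3⟩ := hz
  rw [Subtype.dist_eq, dist_eq_norm] at z3
  rintro ⟨⟨a, b⟩, l⟩ ⟨⟨ha, hb⟩, -⟩ ⟨⟨a', b'⟩, l'⟩ ⟨⟨ha', hb'⟩, -⟩
  have n1 : |a - a'| ≤ ‖(((a, b), l) - ((a', b'), l') : (ℝ × ℝ) × ℝ)‖ :=
    (norm_fst_le ((a, b) - (a', b') : ℝ × ℝ)).trans
      (norm_fst_le (((a, b), l) - ((a', b'), l') : (ℝ × ℝ) × ℝ))
  have n2 : |b - b'| ≤ ‖(((a, b), l) - ((a', b'), l') : (ℝ × ℝ) × ℝ)‖ :=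
    (norm_snd_le ((a, b) - (a', b') : ℝ × ℝ)).trans
      (norm_fst_le (((a, b), l) - ((a', b'), l') : (ℝ × ℝ) × ℝ))
  have n3 : |l - l'| ≤ ‖(((a, b), l) - ((a', b'), l') : (ℝ × ℝ) × ℝ)‖ :=
    norm_snd_le (((a, b), l) - ((a', b'), l') : (ℝ × ℝ) × ℝ)
  set N := ‖(((a, b), l) - ((a', b'), l') : (ℝ × ℝ) × ℝ)‖ with hN
  have e1 := z1 a' ha' a ha
  have e2 := z2 b' hb' b hb
  have e3 : ‖(l - l') • ((z.2 : E3) - ξ)‖ ≤ c / 3 * |l - l'| := by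
    rw [norm_smul, Real.norm_eq_abs, mul_comm]
    gcongr
  rw [lineEquationMap_apply]
  simp only [Prod.fst_sub, Prod.snd_sub] at *
  calc _ = ‖(z.1 a - z.1 a' - (a - a') • deriv γ q.1) - (z.1 b - z.1 b' - (b - b') • deriv γ q.2)
        - (l - l') • ((z.2 : E3) - ξ)‖ := by
          congr 1
          simp only [smul_sub, sub_smul]; abel
    _ ≤ _ := (norm_sub_le _ _).trans (add_le_add (norm_sub_le _ _) le_rfl)
    _ ≤ c / 3 * |a - a'| + c / 3 * |b - b'| + c / 3 * |l - l'| := by linarith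
    _ ≤ c / 3 * N + c / 3 * N + c / 3 * N := by gcongr
    _ = c * N := by ring

/-! ### Persistence, uniqueness and sign of a crossing -/

section Crossing

variable {γ : ℝ → E3} {ξ : Direction} {q : ℝ × ℝ}

theorem IsGenericProjection.mem_Ioo (hξ : IsGenericProjection γ ξ) (hq : q ∈ crossings γ ξ) :
    q.1 ∈ Ioo (0 : ℝ) 1 ∧ q.2 ∈ Ioo (0 : ℝ) 1 := by
  obtain ⟨h1, h2⟩ := hξ.interior q hq
  have := hq.2.1
  exact ⟨⟨h1, this.trans h2⟩, ⟨h1.trans this, h2⟩⟩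

/-- Here `N` is the norm of the inverse of the linearized equation. A perturbation with Lipschitz
constant `N⁻¹ / 2 < N⁻¹` stays injective, which gives uniqueness. It also maps an `ε`-ball onto a
set containing a ball of radius `(N⁻¹ - N⁻¹ / 2) * ε` about the image of the centre; the value at
the old solution tends to `0`, so `0` is attained. -/
theorem exists_nhds_crossing_stable (h : IsSimpleOpenCurve γ) (hξ : IsGenericProjection γ ξ)
    (hq : q ∈ crossings γ ξ) :
    (∃ U ∈ 𝓝 q, ∀ᶠ z in viewNhds γ ξ, ∀ r ∈ crossings z.1 z.2 ∩ U, ∀ r' ∈ crossings z.1 z.2 ∩ U,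
      r = r') ∧
    ∀ W ∈ 𝓝 q, ∀ᶠ z in viewNhds γ ξ, ∃ r ∈ crossings z.1 z.2, r ∈ W := by
  obtain ⟨m1, m2⟩ := hξ.mem_Ioo hq
  obtain ⟨d1, d2⟩ := hξ.smooth q hq
  obtain ⟨e, he⟩ := exists_continuousLinearEquiv_lineEquationMap (hξ.transversal q hq)
  set N : NNReal := ‖(e.symm : E3 →L[ℝ] ((ℝ × ℝ) × ℝ))‖₊ with hN
  have hN0 : 0 < N := e.nnnorm_symm_pos
  have hcN : 0 < N⁻¹ / 2 := by positivity
  have hcN' : N⁻¹ / 2 < N⁻¹ := NNReal.half_lt_self (by positivity)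
  obtain ⟨U, hU, HU⟩ := exists_nhds_approximatesLinearOn (ξ := ξ) h m1 m2 d1 d2 hcN
  refine ⟨⟨U, hU, ?_⟩, ?_⟩
  · filter_upwards [HU] with z hz r hr r' hr'
    rw [← he] at hz
    obtain ⟨-, -, -, l, hl⟩ := mem_crossings_iff.1 hr.1
    obtain ⟨-, -, -, l', hl'⟩ := mem_crossings_iff.1 hr'.1
    have := hz.injOn (Or.inr hcN') (x₁ := (r, l)) (x₂ := (r', l')) ⟨hr.2, mem_univ _⟩
      ⟨hr'.2, mem_univ _⟩ (by simp only [hl, hl', sub_self])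
    exact congrArg Prod.fst this
  · intro W hW
    obtain ⟨-, h12, -, l, hl⟩ := mem_crossings_iff.1 hq
    -- In this open triangle every solution of the equation is an admissible crossing.
    have hreg : {r : ℝ × ℝ | 0 < r.1 ∧ r.1 < r.2 ∧ r.2 < 1} ∈ 𝓝 q :=
      ((isOpen_lt continuous_const continuous_fst).inter
        ((isOpen_lt continuous_fst continuous_snd).inter
          (isOpen_lt continuous_snd continuous_const))).mem_nhds ⟨m1.1, h12, m2.2⟩
    obtain ⟨ε, hε, hball⟩ := Metric.nhds_basis_closedBall.mem_iff.1
      (inter_mem hU (inter_mem hW hreg))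
    have hsmall : ∀ᶠ z in viewNhds γ ξ,
        ‖z.1 q.1 - z.1 q.2 - l • (z.2 : E3)‖ < ((N : ℝ)⁻¹ - ((N⁻¹ / 2 : NNReal) : ℝ)) * ε := by
      have ev (t : ℝ) (ht : t ∈ Icc (0 : ℝ) 1) :
          Tendsto (fun z : (ℝ → E3) × Direction => z.1 t) (viewNhds γ ξ) (𝓝 (γ t)) :=
        (tendsto_eval_c1Nhds h.continuousOn ht).comp (tendsto_fst.prodMk
          (tendsto_const_pure.mono_right (pure_le_nhdsWithin ht)))
      have tz : Tendsto (fun z : (ℝ → E3) × Direction => (z.2 : E3)) (viewNhds γ ξ) (𝓝 (ξ : E3)) :=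
        (continuous_subtype_val.tendsto ξ).comp tendsto_snd
      have T := ((((ev _ (Ioo_subset_Icc_self m1)).sub (ev _ (Ioo_subset_Icc_self m2)))).sub
        (tz.const_smul l)).norm
      rw [hl, sub_self, norm_zero] at T
      refine T.eventually_lt_const ?_
      have : ((N⁻¹ / 2 : NNReal) : ℝ) < (N : ℝ)⁻¹ := by exact_mod_cast hcN'
      have := sub_pos.2 this
      positivity
    filter_upwards [HU, hsmall] with z hz hz'
    rw [← he] at hz
    have hsub : Metric.closedBall (q, l) ε ⊆ U ×ˢ univ := by
      rw [← closedBall_prod_same]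
      exact prod_mono (fun x hx => (hball hx).1) (subset_univ _)
    obtain ⟨x, hx, hx0⟩ := hz.surjOn_closedBall_of_nonlinearRightInverse
      e.toNonlinearRightInverse hε.le hsub (a := 0) (by
        rw [Metric.mem_closedBall, dist_eq_norm, zero_sub, norm_neg]
        exact hz'.le)
    rw [← closedBall_prod_same] at hx
    obtain ⟨-, hxW, hx1, hx2, hx3⟩ := hball hx.1
    exact ⟨x.1, mem_crossings_iff.2 ⟨hx1.le, hx2, hx3.le, x.2, sub_eq_zero.1 hx0⟩, hxW⟩

theorem eventually_crossingSign_eq (h : IsSimpleOpenCurve γ) (hξ : IsGenericProjection γ ξ)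
    (hq : q ∈ crossings γ ξ) :
    ∀ᶠ z in c1Nhds γ ×ˢ 𝓝 q, DifferentiableAt ℝ z.1 z.2.1 → DifferentiableAt ℝ z.1 z.2.2 →
      crossingSign z.1 z.2.1 z.2.2 = crossingSign γ q.1 q.2 := by
  obtain ⟨m1, m2⟩ := hξ.mem_Ioo hq
  obtain ⟨d1, d2⟩ := hξ.smooth q hq
  obtain ⟨-, h12, -, l, hl⟩ := mem_crossings_iff.1 hq
  -- Simplicity of the curve separates the two strands in height, so transversality with respect to
  -- `ξ` makes the determinant defining the sign nonzero.
  have hl0 : l ≠ 0 := by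
    rintro rfl
    rw [zero_smul, sub_eq_zero] at hl
    exact h12.ne (h.injective (Ioo_subset_Icc_self m1) (Ioo_subset_Icc_self m2) hl)
  have hne : tripleProduct (deriv γ q.1) (deriv γ q.2) (γ q.1 - γ q.2) ≠ 0 := by
    have := tripleProduct_smul_smul_smul 1 1 l (deriv γ q.1) (deriv γ q.2) ξ
    rw [one_smul, one_smul] at this
    rw [hl, this]
    exact mul_ne_zero (by simpa using hl0) (hξ.transversal q hq)
  set F := (c1Nhds γ ×ˢ 𝓝 q) ⊓
    𝓟 {z | DifferentiableAt ℝ z.1 z.2.1 ∧ DifferentiableAt ℝ z.1 z.2.2} with hF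
  have f1 : Tendsto (fun z : (ℝ → E3) × (ℝ × ℝ) => (z.1, z.2.1)) F
      ((c1Nhds γ ×ˢ 𝓝 q.1) ⊓ 𝓟 {z | DifferentiableAt ℝ z.1 z.2}) := by
    refine tendsto_inf.2 ⟨?_, tendsto_principal.2 ?_⟩
    · exact (tendsto_fst.prodMk ((continuous_fst.tendsto q).comp tendsto_snd)).mono_left inf_le_left
    · exact eventually_inf_principal.2 (Eventually.of_forall fun z hz => hz.1)
  have f2 : Tendsto (fun z : (ℝ → E3) × (ℝ × ℝ) => (z.1, z.2.2)) F
      ((c1Nhds γ ×ˢ 𝓝 q.2) ⊓ 𝓟 {z | DifferentiableAt ℝ z.1 z.2}) := by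
    refine tendsto_inf.2 ⟨?_, tendsto_principal.2 ?_⟩
    · exact (tendsto_fst.prodMk ((continuous_snd.tendsto q).comp tendsto_snd)).mono_left inf_le_left
    · exact eventually_inf_principal.2 (Eventually.of_forall fun z hz => hz.2)
  have ev {t : ℝ} (ht : t ∈ Ioo (0 : ℝ) 1) : Tendsto (fun z : (ℝ → E3) × ℝ => z.1 z.2)
      ((c1Nhds γ ×ˢ 𝓝 t) ⊓ 𝓟 {z | DifferentiableAt ℝ z.1 z.2}) (𝓝 (γ t)) := by
    have := tendsto_eval_c1Nhds h.continuousOn (Ioo_subset_Icc_self ht)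
    rw [nhdsWithin_eq_nhds.2 (Icc_mem_nhds ht.1 ht.2)] at this
    exact this.mono_left inf_le_left
  have T := (continuous_tripleProduct.tendsto
    (deriv γ q.1, deriv γ q.2, γ q.1 - γ q.2)).comp
    (((h.tendsto_deriv m1 d1).comp f1).prodMk_nhds
      (((h.tendsto_deriv m2 d2).comp f2).prodMk_nhds
        (((ev m1).comp f1).sub ((ev m2).comp f2))))
  have S : ∀ᶠ x : ℝ in 𝓝 (tripleProduct (deriv γ q.1) (deriv γ q.2) (γ q.1 - γ q.2)),
      SignType.sign x = crossingSign γ q.1 q.2 :=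
    (continuousAt_sign_of_ne_zero hne).eventually (p := fun y => y = crossingSign γ q.1 q.2) (by
      rw [nhds_discrete]; exact eventually_pure.2 rfl)
  have := T.eventually S
  rw [hF, eventually_inf_principal] at this
  filter_upwards [this] with z hz a b using hz ⟨a, b⟩

end Crossing

/-! ### Order of the passages and equality of Gauss diagrams -/

theorem passages_eq (γ : ℝ → E3) (ξ : Direction) :
    passages γ ξ = Prod.fst '' crossings γ ξ ∪ Prod.snd '' crossings γ ξ := by
  ext s
  constructor
  · rintro ⟨q, hq, rfl | rfl⟩
    · exact Or.inl ⟨q, hq, rfl⟩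
    · exact Or.inr ⟨q, hq, rfl⟩
  · rintro (⟨q, hq, rfl⟩ | ⟨q, hq, rfl⟩)
    · exact ⟨q, hq, Or.inl rfl⟩
    · exact ⟨q, hq, Or.inr rfl⟩

theorem finite_passages {γ : ℝ → E3} {ξ : Direction} (h : (crossings γ ξ).Finite) :
    (passages γ ξ).Finite := by
  rw [passages_eq]
  exact (h.image _).union (h.image _)

/-- If the crossings of two projections match each other at a distance smaller than half of the
distance of any two passages, and have the same signs, then the diagrams are equal. -/
theorem projectionDiagram_eq_of_matching {γ η : ℝ → E3} {ξ ξ' : Direction} {ε : ℝ}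
    (hfin : (crossings γ ξ).Finite)
    (hdouble : ∀ q ∈ crossings γ ξ, ∀ r ∈ crossings γ ξ,
      (q.1 = r.1 ∨ q.1 = r.2 ∨ q.2 = r.1 ∨ q.2 = r.2) → q = r)
    (hgap : ∀ u ∈ passages γ ξ, ∀ v ∈ passages γ ξ, u ≠ v → 2 * ε ≤ |u - v|)
    (hsub : ∀ r ∈ crossings η ξ', ∃ q ∈ crossings γ ξ, r ∈ Metric.ball q ε)
    (hex : ∀ q ∈ crossings γ ξ, ∃ r ∈ crossings η ξ', r ∈ Metric.ball q ε)
    (huniq : ∀ q ∈ crossings γ ξ, ∀ r ∈ crossings η ξ' ∩ Metric.ball q ε,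
      ∀ r' ∈ crossings η ξ' ∩ Metric.ball q ε, r = r')
    (hsign : ∀ q ∈ crossings γ ξ, ∀ r ∈ crossings η ξ' ∩ Metric.ball q ε,
      crossingSign η r.1 r.2 = crossingSign γ q.1 q.2) :
    projectionDiagram η ξ' = projectionDiagram γ ξ := by
  choose! f hf hfb using hex
  have himage : crossings η ξ' = f '' crossings γ ξ := by
    apply Subset.antisymm
    · intro r hr
      obtain ⟨q, hq, hrq⟩ := hsub r hr
      exact ⟨q, hq, huniq q hq _ ⟨hf q hq, hfb q hq⟩ _ ⟨hr, hrq⟩⟩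
    · rintro _ ⟨q, hq, rfl⟩
      exact hf q hq
  -- A passage belongs to one crossing and in one role only, so the matching `f` of crossings
  -- induces a well-defined map of passages.
  have hψ : ∀ u ∈ passages γ ξ, ∃ v : ℝ, ∀ q ∈ crossings γ ξ,
      (u = q.1 → v = (f q).1) ∧ (u = q.2 → v = (f q).2) := by
    rintro u ⟨p, hp, rfl | rfl⟩
    · refine ⟨(f p).1, fun q hq => ⟨fun e => ?_, fun e => ?_⟩⟩
      · rw [hdouble p hp q hq (Or.inl e)]
      · have := hdouble p hp q hq (Or.inr (Or.inl e))
        rw [← this] at e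
        exact absurd e hp.2.1.ne
    · refine ⟨(f p).2, fun q hq => ⟨fun e => ?_, fun e => ?_⟩⟩
      · have := hdouble p hp q hq (Or.inr (Or.inr (Or.inl e)))
        rw [← this] at e
        exact absurd e hp.2.1.ne'
      · rw [hdouble p hp q hq (Or.inr (Or.inr (Or.inr e)))]
  choose! ψ hψ using hψ
  have p1 : ∀ q ∈ crossings γ ξ, q.1 ∈ passages γ ξ := fun q hq => ⟨q, hq, Or.inl rfl⟩
  have p2 : ∀ q ∈ crossings γ ξ, q.2 ∈ passages γ ξ := fun q hq => ⟨q, hq, Or.inr rfl⟩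
  have ψ1 : ∀ q ∈ crossings γ ξ, ψ q.1 = (f q).1 := fun q hq => (hψ _ (p1 q hq) q hq).1 rfl
  have ψ2 : ∀ q ∈ crossings γ ξ, ψ q.2 = (f q).2 := fun q hq => (hψ _ (p2 q hq) q hq).2 rfl
  have hnear : ∀ u ∈ passages γ ξ, |ψ u - u| < ε := by
    have hb : ∀ q ∈ crossings γ ξ, |(f q).1 - q.1| < ε ∧ |(f q).2 - q.2| < ε := by
      intro q hq
      have := hfb q hq
      rwa [Metric.mem_ball, Prod.dist_eq, max_lt_iff] at this
    rintro u ⟨q, hq, rfl | rfl⟩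
    · rw [ψ1 q hq]; exact (hb q hq).1
    · rw [ψ2 q hq]; exact (hb q hq).2
  -- Passages move by less than `ε` and are at least `2 * ε` apart, so none overtakes another.
  have hmono : StrictMonoOn ψ (passages γ ξ) := by
    intro u hu v hv huv
    have h1 := hgap u hu v hv huv.ne
    rw [abs_sub_comm, abs_of_pos (sub_pos.2 huv)] at h1
    have h2 := (abs_lt.1 (hnear u hu)).2
    have h3 := (abs_lt.1 (hnear v hv)).1
    linarith
  have hpass : passages η ξ' = ψ '' passages γ ξ := by
    ext v
    constructor
    · rintro ⟨r, hr, hv⟩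
      rw [himage] at hr
      obtain ⟨q, hq, rfl⟩ := hr
      rcases hv with rfl | rfl
      · exact ⟨q.1, p1 q hq, ψ1 q hq⟩
      · exact ⟨q.2, p2 q hq, ψ2 q hq⟩
    · rintro ⟨u, ⟨q, hq, rfl | rfl⟩, rfl⟩
      · exact ⟨f q, hf q hq, Or.inl (ψ1 q hq)⟩
      · exact ⟨f q, hf q hq, Or.inr (ψ2 q hq)⟩
  have hindex : ∀ u ∈ passages γ ξ, passageIndex η ξ' (ψ u) = passageIndex γ ξ u := by
    intro u hu
    have : {v | v ∈ passages η ξ' ∧ v < ψ u} = ψ '' {v | v ∈ passages γ ξ ∧ v < u} := by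
      ext v
      rw [hpass]
      constructor
      · rintro ⟨⟨w, hw, rfl⟩, hlt⟩
        exact ⟨w, ⟨hw, (hmono.lt_iff_lt hw hu).1 hlt⟩, rfl⟩
      · rintro ⟨w, ⟨hw, hlt⟩, rfl⟩
        exact ⟨⟨w, hw, rfl⟩, hmono hw hu hlt⟩
    rw [passageIndex, this, (hmono.injOn.mono fun v hv => hv.1).ncard_image]
    rfl
  have hfin' : (crossings η ξ').Finite := himage ▸ hfin.image f
  have hchord : ∀ q ∈ crossings γ ξ,
      (⟨passageIndex η ξ' (f q).1, passageIndex η ξ' (f q).2, crossingSign η (f q).1 (f q).2⟩ :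
        Chord) = ⟨passageIndex γ ξ q.1, passageIndex γ ξ q.2, crossingSign γ q.1 q.2⟩ := by
    intro q hq
    rw [← ψ1 q hq, ← ψ2 q hq, hindex _ (p1 q hq), hindex _ (p2 q hq), ψ1 q hq, ψ2 q hq,
      hsign q hq _ ⟨hf q hq, hfb q hq⟩]
  rw [projectionDiagram, projectionDiagram, dif_pos hfin', dif_pos hfin]
  ext c
  simp only [Finset.mem_image, Finite.mem_toFinset]
  constructor
  · rintro ⟨r, hr, rfl⟩
    rw [himage] at hr
    obtain ⟨q, hq, rfl⟩ := hr
    exact ⟨q, hq, (hchord q hq).symm⟩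
  · rintro ⟨q, hq, rfl⟩
    exact ⟨f q, hf q hq, hchord q hq⟩

/-- The diagram of a generic projection does not change under small changes of the curve and of
the direction of the projection. -/
theorem eventually_projectionDiagram_eq {γ : ℝ → E3} {ξ : Direction} (h : IsSimpleOpenCurve γ)
    (hξ : IsGenericProjection γ ξ) :
    ∀ᶠ z in viewNhds γ ξ, IsGenericProjection z.1 z.2 →
      projectionDiagram z.1 z.2 = projectionDiagram γ ξ := by
  have hfin := hξ.finite
  have hpfin := finite_passages hfin
  have small {U : Set (ℝ × ℝ)} {q : ℝ × ℝ} (hU : U ∈ 𝓝 q) :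
      ∀ᶠ ε : ℝ in 𝓝[>] 0, Metric.ball q ε ⊆ U := by
    obtain ⟨δ, hδ, hs⟩ := Metric.mem_nhds_iff.1 hU
    filter_upwards [nhdsWithin_le_nhds (Iio_mem_nhds hδ)] with ε hε
    exact (Metric.ball_subset_ball (le_of_lt hε)).trans hs
  have e1 : ∀ᶠ ε : ℝ in 𝓝[>] 0, ∀ u ∈ passages γ ξ, ∀ v ∈ passages γ ξ, u ≠ v →
      2 * ε ≤ |u - v| := by
    rw [eventually_all_finite hpfin]
    intro u _
    rw [eventually_all_finite hpfin]
    intro v _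
    by_cases huv : u = v
    · exact Eventually.of_forall fun _ hne => absurd huv hne
    have : 0 < |u - v| / 2 := by
      have := abs_pos.2 (sub_ne_zero.2 huv)
      positivity
    filter_upwards [nhdsWithin_le_nhds (Iio_mem_nhds this)] with ε hε _
    rw [mem_Iio] at hε
    linarith
  have e2 : ∀ᶠ ε : ℝ in 𝓝[>] 0, ∀ q ∈ crossings γ ξ, ∀ᶠ z in viewNhds γ ξ,
      ∀ r ∈ crossings z.1 z.2 ∩ Metric.ball q ε, ∀ r' ∈ crossings z.1 z.2 ∩ Metric.ball q ε,
        r = r' := by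
    rw [eventually_all_finite hfin]
    intro q hq
    obtain ⟨U, hU, H⟩ := (exists_nhds_crossing_stable h hξ hq).1
    filter_upwards [small hU] with ε hε
    filter_upwards [H] with z hz r hr r' hr'
    exact hz r ⟨hr.1, hε hr.2⟩ r' ⟨hr'.1, hε hr'.2⟩
  have e3 : ∀ᶠ ε : ℝ in 𝓝[>] 0, ∀ q ∈ crossings γ ξ, ∀ᶠ z in viewNhds γ ξ,
      ∀ r ∈ Metric.ball q ε, DifferentiableAt ℝ z.1 r.1 → DifferentiableAt ℝ z.1 r.2 →
        crossingSign z.1 r.1 r.2 = crossingSign γ q.1 q.2 := by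
    rw [eventually_all_finite hfin]
    intro q hq
    obtain ⟨P, hP, Q, hQ, H⟩ := eventually_prod_iff.1 (eventually_crossingSign_eq h hξ hq)
    filter_upwards [small hQ] with ε hε
    filter_upwards [tendsto_fst.eventually hP] with z hz r hr
    exact H hz (hε hr)
  -- One radius serves all crossings, as they are finite in number.
  obtain ⟨ε, hε, h1, h2, h3⟩ :=
    ((eventually_mem_nhdsWithin (s := Ioi (0 : ℝ))).and (e1.and (e2.and e3))).exists
  rw [mem_Ioi] at hε
  have h4 := eventually_crossings_subset h hξ (V := ⋃ q ∈ crossings γ ξ, Metric.ball q ε)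
    (isOpen_biUnion fun _ _ => Metric.isOpen_ball)
    fun q hq => mem_biUnion hq (Metric.mem_ball_self hε)
  have h5 : ∀ᶠ z in viewNhds γ ξ, ∀ q ∈ crossings γ ξ,
      ∃ r ∈ crossings z.1 z.2, r ∈ Metric.ball q ε :=
    (eventually_all_finite hfin).2 fun q hq =>
      (exists_nhds_crossing_stable h hξ hq).2 _ (Metric.ball_mem_nhds q hε)
  filter_upwards [(eventually_all_finite hfin).2 h2, (eventually_all_finite hfin).2 h3, h4, h5]
    with z z2 z3 z4 z5 hz
  refine projectionDiagram_eq_of_matching hfin hξ.double h1 ?_ z5 z2 ?_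
  · intro r hr
    simpa using z4 hr
  · intro q hq r hr
    -- Genericity of the nearby projection enters here: its crossings avoid corners, so their signs
    -- are controlled.
    obtain ⟨s1, s2⟩ := hz.smooth r hr.1
    exact z3 q hq r hr.2 s1 s2

/-! ### Finitely many diagrams -/

theorem finite_setOf_chord_le (N : ℕ) : {c : Chord | c.fst ≤ N ∧ c.snd ≤ N}.Finite := by
  have hfin : ((Iic N ×ˢ Iic N) ×ˢ univ : Set ((ℕ × ℕ) × SignType)).Finite :=
    ((finite_Iic N).prod (finite_Iic N)).prod finite_univ
  refine (hfin.preimage (f := fun c : Chord => ((c.fst, c.snd), c.sign)) ?_).subset ?_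
  · rintro ⟨a, b, s⟩ _ ⟨a', b', s'⟩ _ h
    simp only [Prod.mk.injEq] at h
    obtain ⟨⟨rfl, rfl⟩, rfl⟩ := h
    rfl
  · rintro c ⟨h1, h2⟩
    exact ⟨⟨h1, h2⟩, mem_univ _⟩

/-- The diagrams with passages numbered up to `2 M`. -/
noncomputable def boundedDiagrams (M : ℕ) : Finset GaussDiagram :=
  (finite_setOf_chord_le (2 * M)).toFinset.powerset

theorem ncard_passages_le {γ : ℝ → E3} {ξ : Direction} (h : (crossings γ ξ).Finite) :
    (passages γ ξ).ncard ≤ 2 * (crossings γ ξ).ncard := by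
  rw [passages_eq]
  refine (ncard_union_le _ _).trans ?_
  have h1 := ncard_image_le (f := Prod.fst) h
  have h2 := ncard_image_le (f := Prod.snd) h
  omega

theorem projectionDiagram_mem_boundedDiagrams {γ : ℝ → E3} {ξ : Direction} {M : ℕ}
    (h : (crossings γ ξ).Finite) (hM : (crossings γ ξ).ncard ≤ M) :
    projectionDiagram γ ξ ∈ boundedDiagrams M := by
  classical
  have hindex (s : ℝ) : passageIndex γ ξ s ≤ 2 * M :=
    (ncard_le_ncard (fun _ hu => hu.1) (finite_passages h)).trans
      ((ncard_passages_le h).trans (by omega))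
  rw [boundedDiagrams, Finset.mem_powerset, projectionDiagram, dif_pos h]
  intro c hc
  obtain ⟨q, -, rfl⟩ := Finset.mem_image.1 hc
  exact (Finite.mem_toFinset _).2 ⟨hindex _, hindex _⟩

theorem exists_degree_bound (M : ℕ) : ∃ m : ℕ, ∀ D ∈ boundedDiagrams M, ∀ k : ℤ,
    (m : ℤ) < |k| → D.normalized.coeff k = 0 := by
  refine ⟨(boundedDiagrams M).sup fun D => D.normalized.coeff.support.sup Int.natAbs,
    fun D hD k hk => ?_⟩
  by_contra hne
  have h1 : k.natAbs ≤ D.normalized.coeff.support.sup Int.natAbs :=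
    Finset.le_sup (f := Int.natAbs) (Finsupp.mem_support_iff.2 hne)
  have h2 := Finset.le_sup (f := fun D : GaussDiagram =>
    D.normalized.coeff.support.sup Int.natAbs) hD
  have h3 := h1.trans h2
  rw [Int.abs_eq_natAbs] at hk
  omega

theorem exists_coeff_bound (M : ℕ) : ∃ C : ℝ, ∀ D ∈ boundedDiagrams M, ∀ k : ℤ,
    ‖D.normalized.coeff k‖ ≤ C := by
  refine ⟨∑ D ∈ boundedDiagrams M, ∑ k ∈ D.normalized.coeff.support, ‖D.normalized.coeff k‖,
    fun D hD k => ?_⟩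
  refine le_trans ?_ (Finset.single_le_sum (f := fun D : GaussDiagram =>
    ∑ k ∈ D.normalized.coeff.support, ‖D.normalized.coeff k‖)
    (fun D _ => Finset.sum_nonneg fun _ _ => norm_nonneg _) hD)
  by_cases hk : k ∈ D.normalized.coeff.support
  · exact Finset.single_le_sum (f := fun k => ‖D.normalized.coeff k‖)
      (fun _ _ => norm_nonneg _) hk
  · rw [Finsupp.notMem_support_iff.1 hk, norm_zero]
    exact Finset.sum_nonneg fun _ _ => norm_nonneg _

/-! ### The normalized bracket polynomial of tame curves -/

/-- On a measurable conull set of points satisfying `p` the function is continuous for the relative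
topology, and its values elsewhere do not matter. -/
theorem aestronglyMeasurable_of_locally_constant {X : Type*} [TopologicalSpace X]
    [MeasurableSpace X] [OpensMeasurableSpace X] {μ : Measure X} {f : X → ℝ} {p : X → Prop}
    (hp : ∀ᵐ x ∂μ, p x) (hf : ∀ x, p x → ∀ᶠ y in 𝓝 x, p y → f y = f x) :
    AEStronglyMeasurable f μ := by
  obtain ⟨s, hs, hsm, hsp⟩ := hp.exists_measurable_mem
  have hc : ContinuousOn f s := by
    intro x hx
    refine (continuousWithinAt_const (b := f x)).congr_of_eventuallyEq ?_ rfl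
    filter_upwards [nhdsWithin_le_nhds (hf x (hsp x hx)), self_mem_nhdsWithin] with y hy hys
    exact hy (hsp y hys)
  rw [← Measure.restrict_eq_self_of_ae_mem hs]
  exact hc.aestronglyMeasurable hsm

instance : IsFiniteMeasure sphereArea := inferInstanceAs (IsFiniteMeasure (Measure.toSphere _))

theorem IsSimpleOpenCurve.aestronglyMeasurable_projectionCoeff {γ : ℝ → E3}
    (h : IsSimpleOpenCurve γ) (hg : ∀ᵐ ξ ∂sphereArea, IsGenericProjection γ ξ) (k : ℤ) :
    AEStronglyMeasurable (projectionCoeff γ k) sphereArea := by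
  refine aestronglyMeasurable_of_locally_constant hg fun ξ hξ => ?_
  have h1 := eventually_projectionDiagram_eq h hξ
  have h2 : Tendsto (fun ξ' : Direction => (γ, ξ')) (𝓝 ξ) (viewNhds γ ξ) :=
    (tendsto_const_pure.mono_right (pure_le_c1Nhds γ)).prodMk tendsto_id
  filter_upwards [h2.eventually h1] with ξ' h' hξ'
  rw [projectionCoeff, projectionCoeff, h' hξ']

namespace IsTameOpenCurve

variable {M : ℕ} {γ : ℝ → E3}

theorem ae_isGenericProjection (h : IsTameOpenCurve M γ) :
    ∀ᵐ ξ ∂sphereArea, IsGenericProjection γ ξ := h.generic.mono fun _ hξ => hξ.1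

theorem ae_projectionDiagram_mem (h : IsTameOpenCurve M γ) :
    ∀ᵐ ξ ∂sphereArea, projectionDiagram γ ξ ∈ boundedDiagrams M :=
  h.generic.mono fun _ hξ => projectionDiagram_mem_boundedDiagrams hξ.1.finite hξ.2

theorem hasNormalizedBracket (h : IsTameOpenCurve M γ) {m : ℕ}
    (hm : ∀ D ∈ boundedDiagrams M, ∀ k : ℤ, (m : ℤ) < |k| → D.normalized.coeff k = 0) :
    HasNormalizedBracket γ m where
  generic := h.ae_isGenericProjection
  integrable k := by
    obtain ⟨C, hC⟩ := exists_coeff_bound M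
    exact Integrable.of_bound
      (h.aestronglyMeasurable_projectionCoeff h.ae_isGenericProjection k) C
      (h.ae_projectionDiagram_mem.mono fun ξ hξ => hC _ hξ k)
  degree_le k hk := by
    rw [normalizedBracket, integral_eq_zero_of_ae, mul_zero]
    exact h.ae_projectionDiagram_mem.mono fun ξ hξ => hm _ hξ k hk

theorem tendsto_normalizedBracket (h : IsTameOpenCurve M γ) {η : ℕ → ℝ → E3}
    (hη : ∀ n, IsTameOpenCurve M (η n)) (ht : Tendsto η atTop (c1Nhds γ)) (k : ℤ) :
    Tendsto (fun n => normalizedBracket (η n) k) atTop (𝓝 (normalizedBracket γ k)) := by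
  obtain ⟨C, hC⟩ := exists_coeff_bound M
  refine Tendsto.const_mul _ (tendsto_integral_of_dominated_convergence (fun _ => C)
    (fun n => (hη n).aestronglyMeasurable_projectionCoeff (hη n).ae_isGenericProjection k)
    (integrable_const C)
    (fun n => (hη n).ae_projectionDiagram_mem.mono fun ξ hξ => hC _ hξ k) ?_)
  -- A sequence imposes only countably many conull conditions, so almost every direction is generic
  -- for all the curves at once.
  filter_upwards [h.ae_isGenericProjection,
    ae_all_iff.2 fun n => (hη n).ae_isGenericProjection] with ξ hξ hall
  have h2 : Tendsto (fun n => (η n, ξ)) atTop (viewNhds γ ξ) :=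
    ht.prodMk tendsto_const_nhds
  refine tendsto_const_nhds.congr' ?_
  filter_upwards [h2.eventually (eventually_projectionDiagram_eq h.toIsSimpleOpenCurve hξ)] with n hn
  rw [projectionCoeff, projectionCoeff, hn (hall n)]

theorem exists_dist_bracketVector_lt (h : IsTameOpenCurve M γ) (m : ℕ) {ε : ℝ} (hε : 0 < ε) :
    ∃ δ : ℝ, 0 < δ ∧ ∀ η : ℝ → E3, IsTameOpenCurve M η → IsC1Close δ γ η →
      dist (bracketVector m γ) (bracketVector m η) < ε := by
  by_contra! hcon
  choose! η hη hclose hdist using fun n : ℕ => hcon (1 / ((n : ℝ) + 1)) Nat.one_div_pos_of_nat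
  have ht : Tendsto η atTop (c1Nhds γ) := by
    rw [(hasBasis_c1Nhds γ).tendsto_right_iff]
    intro δ hδ
    filter_upwards [tendsto_one_div_add_atTop_nhds_zero_nat.eventually_lt_const hδ] with n hn
    exact (hclose n).mono hn.le
  have hv : Tendsto (fun n => bracketVector m (η n)) atTop (𝓝 (bracketVector m γ)) :=
    (PiLp.continuous_toLp 2 _).tendsto _ |>.comp
      (tendsto_pi_nhds.2 fun k => h.tendsto_normalizedBracket hη ht k)
  have := (tendsto_const_nhds (x := bracketVector m γ)).dist hv
  rw [dist_self] at this
  obtain ⟨n, hn⟩ := (this.eventually_lt_const hε).exists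
  exact absurd hn (not_lt.2 (hdist n))

end IsTameOpenCurve

/-! ### Null sets of directions -/

/-- Polar coordinates and Fubini: for almost every `ξ` the property holds at `r • ξ` for almost
every radius `r`. As the radial measure is nonzero, such an `r` exists, and `hp` descends to `ξ`. -/
theorem ae_sphereArea_of_ae {p : E3 → Prop} (h : ∀ᵐ x : E3, p x)
    (hp : ∀ x : E3, ∀ r : ℝ, 0 < r → p (r • x) → p x) : ∀ᵐ ξ : Direction ∂sphereArea, p ξ := by
  have h1 := (volume : Measure E3).measurePreserving_homeomorphUnitSphereProd
  have h2 : ∀ᵐ x : ({0}ᶜ : Set E3) ∂((volume : Measure E3).comap (↑)), p x := by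
    have he := MeasurableEmbedding.subtype_coe (measurableSet_singleton (0 : E3)).compl
    rw [ae_iff, he.comap_apply]
    refine measure_mono_null ?_ h
    rintro _ ⟨x, hx, rfl⟩
    exact hx
  have h3 : ∀ᵐ z ∂(sphereArea.prod (Measure.volumeIoiPow (Module.finrank ℝ E3 - 1))),
      p ((homeomorphUnitSphereProd E3).symm z : E3) := by
    have := (h1.symm (homeomorphUnitSphereProd E3).toMeasurableEquiv).quasiMeasurePreserving.ae h2
    exact this
  have h4 := Measure.ae_ae_of_ae_prod h3
  have hne : NeBot (ae (Measure.volumeIoiPow (Module.finrank ℝ E3 - 1))) := by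
    rw [ae_neBot]
    intro h0
    have := Measure.volumeIoiPow_apply_Iio (Module.finrank ℝ E3 - 1) ⟨1, mem_Ioi.2 one_pos⟩
    rw [h0] at this
    simp only [Measure.coe_zero, Pi.zero_apply, one_pow] at this
    have h5 := ENNReal.ofReal_eq_zero.1 this.symm
    exact absurd h5 (not_le.2 (by positivity))
  filter_upwards [h4] with ξ hξ
  obtain ⟨r, hr⟩ := hξ.exists
  exact hp _ r r.2 (by simpa using hr)

/-- Some `N ≠ 0` is orthogonal to `u`, `v`, `w`, so their span lies in a proper subspace, which is
null. -/
theorem ae_ne_span_of_tripleProduct_eq_zero {u v w : E3} (h : tripleProduct u v w = 0) :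
    ∀ᵐ X : E3, ∀ x y z : ℝ, X ≠ x • u + y • v + z • w := by
  obtain ⟨N, hN, hM⟩ := Matrix.exists_mulVec_eq_zero_iff.2 h
  have hin (x : E3) : inner ℝ (WithLp.toLp 2 N : E3) x = x 0 * N 0 + x 1 * N 1 + x 2 * N 2 := by
    simp [PiLp.inner_apply, Fin.sum_univ_three]
  have h0 := congrFun hM 0
  have h1 := congrFun hM 1
  have h2 := congrFun hM 2
  simp [Matrix.mulVec, dotProduct, Fin.sum_univ_three] at h0 h1 h2
  set K : Submodule ℝ E3 := LinearMap.ker (innerₛₗ ℝ (WithLp.toLp 2 N : E3)) with hK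
  have hKtop : K ≠ ⊤ := by
    intro htop
    have : (WithLp.toLp 2 N : E3) ∈ K := htop ▸ Submodule.mem_top
    rw [hK, LinearMap.mem_ker, innerₛₗ_apply_apply, inner_self_eq_zero] at this
    exact hN (by simpa using this)
  have hnull := Measure.addHaar_submodule (volume : Measure E3) K hKtop
  have hae : ∀ᵐ X : E3, X ∉ K := by
    rw [ae_iff]; simpa using hnull
  filter_upwards [hae] with X hX x y z e
  apply hX
  rw [hK, LinearMap.mem_ker, innerₛₗ_apply_apply, hin, e]
  simp only [PiLp.add_apply, PiLp.smul_apply, smul_eq_mul]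
  linear_combination x * h0 + y * h1 + z * h2

theorem tripleProduct_zero_right (u v : E3) : tripleProduct u v 0 = 0 := by
  simp [tripleProduct_eq]

theorem ae_sphereArea_ne_span {u v w : E3} (h : tripleProduct u v w = 0) :
    ∀ᵐ ξ : Direction ∂sphereArea, ∀ x y z : ℝ, (ξ : E3) ≠ x • u + y • v + z • w := by
  refine ae_sphereArea_of_ae (ae_ne_span_of_tripleProduct_eq_zero h) ?_
  intro X r _ hX x y z e
  refine hX (r * x) (r * y) (r * z) ?_
  rw [e]
  simp only [smul_add, mul_smul]

theorem ae_sphereArea_ne_span_pair (u v : E3) :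
    ∀ᵐ ξ : Direction ∂sphereArea, ∀ x y : ℝ, (ξ : E3) ≠ x • u + y • v := by
  filter_upwards [ae_sphereArea_ne_span (tripleProduct_zero_right u v)] with ξ hξ x y e
  exact hξ x y 0 (by simpa using e)

theorem ae_sphereArea_tripleProduct_ne_zero {u v w : E3} (h : tripleProduct u v w ≠ 0) :
    ∀ᵐ ξ : Direction ∂sphereArea, tripleProduct u v ξ ≠ 0 := by
  filter_upwards [ae_sphereArea_ne_span_pair u v] with ξ hξ e
  -- Cramer's expansion of `ξ` in `u`, `v`, `w`; if the coefficient of `w` vanishes, `ξ` lies in the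
  -- plane of `u` and `v`.
  have key : tripleProduct u v w • (ξ : E3) =
      (-tripleProduct v w ξ) • (-u) + (-tripleProduct u w ξ) • v + tripleProduct u v ξ • w := by
    ext i
    simp only [tripleProduct_eq, PiLp.add_apply, PiLp.smul_apply, PiLp.neg_apply, smul_eq_mul]
    fin_cases i <;> simp <;> ring
  rw [e, zero_smul, add_zero] at key
  refine hξ ((tripleProduct u v w)⁻¹ * tripleProduct v w ξ)
    ((tripleProduct u v w)⁻¹ * -tripleProduct u w ξ) ?_
  rw [mul_smul, mul_smul, ← smul_add, eq_inv_smul_iff₀ h, key]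
  simp

/-- Almost no direction is the direction of a line that meets three given lines, two of which are
skew to the third one. -/
theorem ae_sphereArea_not_transversal {a b c u v w : E3} (h1 : tripleProduct u w (a - c) ≠ 0)
    (h2 : tripleProduct v w (b - c) ≠ 0) :
    ∀ᵐ ξ : Direction ∂sphereArea, ∀ s t l : ℝ,
      tripleProduct (a + s • u - c) (b + t • v - c) w = 0 →
        (ξ : E3) ≠ l • (b + t • v - (a + s • u)) := by
  set α := tripleProduct (a - c) (b - c) w with hα
  set β := tripleProduct u (b - c) w with hβ
  set G := tripleProduct (a - c) v w with hG
  set D := tripleProduct u v w with hD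
  -- The coplanarity condition is affine in `t`, so in general `s` determines `t` as a rational
  -- function.
  have hexp (s t : ℝ) : tripleProduct (a + s • u - c) (b + t • v - c) w
      = (α + β * s) + t * (G + D * s) := by
    rw [hα, hβ, hG, hD]
    simp only [tripleProduct_eq, PiLp.add_apply, PiLp.sub_apply, PiLp.smul_apply, smul_eq_mul]
    ring
  -- The quadratic identity below expresses the product of the determinants in `h1` and `h2` through
  -- `G` and `D`, which therefore cannot both vanish. Hence at most one `s` is exceptional.
  have hGD : D = 0 → G ≠ 0 := by
    intro hD0 hG0
    have : tripleProduct u w (a - c) * tripleProduct v w (b - c) =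
        G * tripleProduct u w (b - c) - D * tripleProduct (a - c) w (b - c) := by
      rw [hG, hD]
      simp only [tripleProduct_eq]
      ring
    rw [hD0, hG0] at this
    simp only [zero_mul, sub_zero, mul_eq_zero] at this
    exact this.elim h1 h2
  refine ae_sphereArea_of_ae (p := fun X : E3 => ∀ s t l : ℝ,
      tripleProduct (a + s • u - c) (b + t • v - c) w = 0 →
        X ≠ l • (b + t • v - (a + s • u))) ?_ ?_
  -- The parameters are `s = y 0` and the scaling `l = y 1`. The idle third coordinate, set to `0`,
  -- makes the domain a null set of `E3`, and a differentiable map of `E3` to itself sends it to a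
  -- null set.
  · set f : E3 → E3 := fun y =>
      y 1 • (b + (-(α + β * y 0) / (G + D * y 0)) • v - (a + y 0 • u)) with hf
    set S : Set E3 := {y | G + D * y 0 ≠ 0 ∧ y 2 = 0} with hS
    have hSnull : (volume : Measure E3) S = 0 := by
      have hz : tripleProduct (EuclideanSpace.single 0 1 : E3) (EuclideanSpace.single 1 1) 0 = 0 :=
        tripleProduct_zero_right _ _
      have := ae_ne_span_of_tripleProduct_eq_zero hz
      refine measure_mono_null ?_ this
      intro y hy hcon
      refine hcon (y 0) (y 1) 0 ?_
      ext i
      fin_cases i <;> simp [hy.2]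
    have hdiff : DifferentiableOn ℝ f S := by
      intro y hy
      have c0 : DifferentiableWithinAt ℝ (fun y : E3 => y 0) S y :=
        (EuclideanSpace.proj (𝕜 := ℝ) (0 : Fin 3)).differentiableWithinAt
      have c1 : DifferentiableWithinAt ℝ (fun y : E3 => y 1) S y :=
        (EuclideanSpace.proj (𝕜 := ℝ) (1 : Fin 3)).differentiableWithinAt
      have cd : DifferentiableWithinAt ℝ (fun y : E3 => G + D * y 0) S y :=
        (c0.const_mul D).const_add G
      have cn : DifferentiableWithinAt ℝ (fun y : E3 => -(α + β * y 0)) S y :=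
        ((c0.const_mul β).const_add α).fun_neg
      have cq : DifferentiableWithinAt ℝ
          (fun y : E3 => -(α + β * y 0) / (G + D * y 0)) S y := by
        simp only [div_eq_mul_inv]
        exact cn.mul (cd.inv (by exact hy.1))
      exact c1.smul (((cq.smul_const v).const_add b).sub ((c0.smul_const u).const_add a))
    have himage := addHaar_image_eq_zero_of_differentiableOn_of_addHaar_eq_zero volume hdiff hSnull
    have hae : ∀ᵐ X : E3, X ∉ f '' S := measure_eq_zero_iff_ae_notMem.1 himage
    filter_upwards [hae, ae_ne_span_of_tripleProduct_eq_zero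
      (tripleProduct_zero_right v (b - (a + (-G / D) • u)))] with X hX1 hX2 s t l he hX
    rw [hexp] at he
    -- At the exceptional `s` the parameter `t` is free, but the point `a + s • u` is fixed and the
    -- directions stay in one plane.
    by_cases hs : G + D * s = 0
    · have hD0 : D ≠ 0 := by
        intro h0
        rw [h0, zero_mul, add_zero] at hs
        exact hGD h0 hs
      have hs' : s = -G / D := by
        field_simp
        linarith
      refine hX2 (l * t) l 0 ?_
      rw [hX, ← hs', smul_zero, add_zero, mul_smul, ← smul_add]
      congr 1; abel
    · refine hX1 ⟨WithLp.toLp 2 ![s, l, 0], ⟨by simpa using hs, by simp⟩, ?_⟩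
      have ht : t = -(α + β * s) / (G + D * s) := by
        rw [eq_div_iff hs]
        linarith
      simp only [hf]
      rw [hX, ht]
      simp
  · intro X r _ hX s t l he e
    refine hX s t (r * l) he ?_
    rw [e, mul_smul]

/-! ### Polygonal curves -/

section Polygon

variable {n : ℕ} {p : Fin (n + 1) → E3}

/-- The edge vectors of a polygonal chain. -/
def edgeVector (p : Fin (n + 1) → E3) (i : Fin n) : E3 := p i.succ - p i.castSucc

theorem sum_ite_edgeVector (p : Fin (n + 1) → E3) (i : Fin (n + 1)) :
    ∑ j : Fin n, (if (j : ℕ) < i then edgeVector p j else 0) = p i - p 0 := by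
  induction i using Fin.induction with
  | zero => simp
  | succ i ih =>
    have : ∀ j : Fin n, (if (j : ℕ) < i.succ then edgeVector p j else 0) =
        (if (j : ℕ) < i.castSucc then edgeVector p j else 0) +
          (if j = i then edgeVector p j else 0) := by
      intro j
      rcases lt_trichotomy j i with h | h | h
      · have h' : (j : ℕ) < i := h
        simp [h', h.ne, h'.trans (Nat.lt_succ_self _)]
      · simp [h]
      · have h' : (i : ℕ) < j := h
        simp [h.ne', show ¬ (j : ℕ) < i by omega, show ¬ (j : ℕ) < i + 1 by omega]
    rw [Finset.sum_congr rfl fun j _ => this j, Finset.sum_add_distrib, ih]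
    simp [edgeVector]

/-- On edge `i` the clamped coefficients are `1` for all earlier edges and `0` for all later ones,
so the sum telescopes. -/
theorem polygonalCurve_eq (i : Fin n) {t : ℝ} (h1 : (i : ℝ) ≤ n * t) (h2 : n * t ≤ i + 1) :
    polygonalCurve p t = p i.castSucc + (n * t - i) • edgeVector p i := by
  have : ∀ j : Fin n, max 0 (min 1 (n * t - j)) • (p j.succ - p j.castSucc) =
      (if (j : ℕ) < i.castSucc then edgeVector p j else 0) +
        (if j = i then (n * t - j) • edgeVector p j else 0) := by
    intro j
    rw [← edgeVector]
    rcases lt_trichotomy j i with h | h | h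
    · have h' : (j : ℕ) < i := h
      have h'' : (j : ℝ) + 1 ≤ i := by exact_mod_cast h'
      rw [min_eq_left (by linarith), max_eq_right zero_le_one]
      simp [h', h.ne]
    · subst h
      rw [min_eq_right (by linarith), max_eq_right (by linarith)]
      simp
    · have h' : (i : ℕ) < j := h
      have h'' : (i : ℝ) + 1 ≤ j := by exact_mod_cast h'
      rw [max_eq_left ((min_le_right _ _).trans (by linarith))]
      simp [h.ne', show ¬ (j : ℕ) < i by omega]
  rw [polygonalCurve, Finset.sum_congr rfl fun j _ => this j, Finset.sum_add_distrib,
    sum_ite_edgeVector]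
  simp only [Finset.sum_ite_eq', Finset.mem_univ, if_true]
  abel

/-- The ceiling assigns a break point to the edge that ends there; the floor in `exists_right_edge`
assigns it to the edge that begins there. -/
theorem exists_left_edge (hn : 1 ≤ n) {t : ℝ} (h0 : 0 < t) (h1 : t ≤ 1) :
    ∃ i : Fin n, (i : ℝ) < n * t ∧ n * t ≤ i + 1 := by
  have hn' : (0 : ℝ) < n := by exact_mod_cast hn
  have hpos : 0 < n * t := mul_pos hn' h0
  have hc : 0 < ⌈n * t⌉₊ := Nat.ceil_pos.2 hpos
  have hle : ⌈n * t⌉₊ ≤ n := Nat.ceil_le.2 (by nlinarith)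
  have e : ((⌈n * t⌉₊ - 1 : ℕ) : ℝ) + 1 = ⌈n * t⌉₊ := by
    exact_mod_cast Nat.sub_add_cancel hc
  refine ⟨⟨⌈n * t⌉₊ - 1, by omega⟩, ?_, ?_⟩
  · have := Nat.ceil_lt_add_one hpos.le
    dsimp only
    linarith
  · dsimp only
    rw [e]
    exact Nat.le_ceil _

theorem exists_right_edge (hn : 1 ≤ n) {t : ℝ} (h0 : 0 ≤ t) (h1 : t < 1) :
    ∃ i : Fin n, (i : ℝ) ≤ n * t ∧ n * t < i + 1 := by
  have hn' : (0 : ℝ) < n := by exact_mod_cast hn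
  have hpos : 0 ≤ n * t := mul_nonneg hn'.le h0
  refine ⟨⟨⌊n * t⌋₊, (Nat.floor_lt hpos).2 (by nlinarith)⟩, Nat.floor_le hpos,
    Nat.lt_floor_add_one _⟩

theorem exists_edge (hn : 1 ≤ n) {t : ℝ} (ht : t ∈ Icc (0 : ℝ) 1) :
    ∃ i : Fin n, (i : ℝ) ≤ n * t ∧ n * t ≤ i + 1 := by
  rcases eq_or_lt_of_le ht.1 with h | h
  · obtain ⟨i, h1, h2⟩ := exists_right_edge hn ht.1 (by rw [← h]; exact one_pos)
    exact ⟨i, h1, h2.le⟩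
  · obtain ⟨i, h1, h2⟩ := exists_left_edge hn h ht.2
    exact ⟨i, h1.le, h2⟩

theorem polygonalCurve_vertex (hn : 1 ≤ n) (k : Fin (n + 1)) {t : ℝ} (h : n * t = k) :
    polygonalCurve p t = p k := by
  induction k using Fin.lastCases with
  | last =>
    have hlt : n - 1 < n := by omega
    have e : ((n - 1 : ℕ) : ℝ) + 1 = n := by exact_mod_cast Nat.sub_add_cancel hn
    rw [Fin.val_last] at h
    rw [polygonalCurve_eq ⟨n - 1, hlt⟩ (by dsimp only; linarith) (by dsimp only; linarith), h]
    have e' : (n : ℝ) - ((n - 1 : ℕ) : ℝ) = 1 := by linarith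
    have e'' : (⟨n - 1, hlt⟩ : Fin n).succ = Fin.last n := by
      ext; simp; omega
    dsimp only
    rw [e', one_smul, edgeVector, e'']
    abel
  | cast i =>
    rw [Fin.val_castSucc] at h
    rw [polygonalCurve_eq i h.ge (by linarith), h]
    simp

theorem hasDerivAt_edge (i : Fin n) (t : ℝ) :
    HasDerivAt (fun t : ℝ => p i.castSucc + (n * t - i) • edgeVector p i)
      ((n : ℝ) • edgeVector p i) t := by
  have h := ((((hasDerivAt_id t).const_mul (n : ℝ)).sub_const (i : ℝ)).smul_const
    (edgeVector p i)).const_add (p i.castSucc)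
  simpa using h

theorem leftTangent_polygonalCurve (i : Fin n) {t : ℝ} (h1 : (i : ℝ) < n * t)
    (h2 : n * t ≤ i + 1) : leftTangent (polygonalCurve p) t = (n : ℝ) • edgeVector p i := by
  have h := (hasDerivAt_edge (p := p) i t).hasDerivWithinAt (s := Iic t)
  refine (h.congr_of_eventuallyEq ?_ (polygonalCurve_eq i h1.le h2)).derivWithin
    (uniqueDiffWithinAt_Iic t)
  have hc : ∀ᶠ s : ℝ in 𝓝 t, (i : ℝ) < n * s :=
    (by fun_prop : Continuous fun s : ℝ => n * s).continuousAt.eventually_const_lt h1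
  filter_upwards [nhdsWithin_le_nhds hc, self_mem_nhdsWithin] with s hs hst
  exact polygonalCurve_eq i hs.le
    ((mul_le_mul_of_nonneg_left hst (Nat.cast_nonneg n)).trans h2)

theorem rightTangent_polygonalCurve (i : Fin n) {t : ℝ} (h1 : (i : ℝ) ≤ n * t)
    (h2 : n * t < i + 1) : rightTangent (polygonalCurve p) t = (n : ℝ) • edgeVector p i := by
  have h := (hasDerivAt_edge (p := p) i t).hasDerivWithinAt (s := Ici t)
  refine (h.congr_of_eventuallyEq ?_ (polygonalCurve_eq i h1 h2.le)).derivWithin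
    (uniqueDiffWithinAt_Ici t)
  have hc : ∀ᶠ s : ℝ in 𝓝 t, n * s < (i : ℝ) + 1 :=
    (by fun_prop : Continuous fun s : ℝ => n * s).continuousAt.eventually_lt_const h2
  filter_upwards [nhdsWithin_le_nhds hc, self_mem_nhdsWithin] with s hs hst
  exact polygonalCurve_eq i
    (h1.trans (mul_le_mul_of_nonneg_left hst (Nat.cast_nonneg n))) hs.le

theorem hasDerivAt_polygonalCurve (i : Fin n) {t : ℝ} (h1 : (i : ℝ) < n * t)
    (h2 : n * t < i + 1) :
    HasDerivAt (polygonalCurve p) ((n : ℝ) • edgeVector p i) t := by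
  refine (hasDerivAt_edge (p := p) i t).congr_of_eventuallyEq ?_
  have hc : ∀ᶠ s : ℝ in 𝓝 t, (i : ℝ) < n * s :=
    (by fun_prop : Continuous fun s : ℝ => n * s).continuousAt.eventually_const_lt h1
  have hc' : ∀ᶠ s : ℝ in 𝓝 t, n * s < (i : ℝ) + 1 :=
    (by fun_prop : Continuous fun s : ℝ => n * s).continuousAt.eventually_lt_const h2
  filter_upwards [hc, hc'] with s hs hs'
  exact polygonalCurve_eq i hs.le hs'.le

theorem edgeVector_ne_zero (hn : 1 ≤ n) (hp : InjOn (polygonalCurve p) (Icc 0 1)) (i : Fin n) :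
    edgeVector p i ≠ 0 := by
  have hn' : (0 : ℝ) < n := by exact_mod_cast hn
  have hi : ((i : ℕ) : ℝ) + 1 ≤ n := by exact_mod_cast i.2
  intro h
  have e1 : (n : ℝ) * (i / n) = i := by field_simp
  have e2 : (n : ℝ) * ((i + 1) / n) = i + 1 := by field_simp
  have h1 := polygonalCurve_eq (p := p) i (t := i / n) (by rw [e1]) (by rw [e1]; linarith)
  have h2 := polygonalCurve_eq (p := p) i (t := (i + 1) / n) (by rw [e2]; linarith) (by rw [e2])
  rw [h, smul_zero] at h1 h2
  have := hp ⟨by positivity, by rw [div_le_one hn']; linarith⟩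
    ⟨by positivity, by rw [div_le_one hn']; exact hi⟩ (h1.trans h2.symm)
  rw [div_eq_div_iff hn'.ne' hn'.ne'] at this
  have := mul_right_cancel₀ hn'.ne' this
  linarith

theorem isSimpleOpenCurve_polygonalCurve (hn : 1 ≤ n) (hp : InjOn (polygonalCurve p) (Icc 0 1)) :
    IsSimpleOpenCurve (polygonalCurve p) where
  injective := hp
  piecewise := by
    have hn' : (0 : ℝ) < n := by exact_mod_cast hn
    refine ⟨(Finset.range (n + 1)).image fun k : ℕ => (k : ℝ) / n, fun a b ha hab hb hdis => ?_⟩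
    have hB (k : ℕ) (hk : k ≤ n) : (k : ℝ) / n ≤ a ∨ b ≤ (k : ℝ) / n := by
      by_contra! hcon
      refine Set.disjoint_left.1 hdis hcon ?_
      simp only [Finset.coe_image, mem_image]
      exact ⟨k, by simpa using Nat.lt_succ_of_le hk, rfl⟩
    obtain ⟨i, h1, h2⟩ := exists_edge hn (t := (a + b) / 2) ⟨by linarith, by linarith⟩
    have g1 : (i : ℝ) / n ≤ a := by
      refine (hB i i.2.le).resolve_right fun h => ?_
      rw [le_div_iff₀ hn'] at h
      nlinarith
    have g2 : b ≤ ((i : ℝ) + 1) / n := by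
      have := (hB (i + 1) i.2)
      push_cast at this
      refine this.resolve_left fun h => ?_
      rw [div_le_iff₀ hn'] at h
      nlinarith
    rw [div_le_iff₀ hn'] at g1
    rw [le_div_iff₀ hn'] at g2
    have hc : ContDiff ℝ 1 fun t : ℝ => p i.castSucc + (n * t - i) • edgeVector p i := by
      fun_prop
    refine hc.contDiffOn.congr fun t ht => polygonalCurve_eq i ?_ ?_
    · nlinarith [ht.1]
    · nlinarith [ht.2]
  regular_zero := by
    have hn' : (n : ℝ) ≠ 0 := by positivity
    obtain ⟨i, h1, h2⟩ := exists_right_edge hn le_rfl one_pos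
    rw [rightTangent_polygonalCurve i h1 h2]
    exact smul_ne_zero hn' (edgeVector_ne_zero hn hp i)
  regular_one := by
    have hn' : (n : ℝ) ≠ 0 := by positivity
    obtain ⟨i, h1, h2⟩ := exists_left_edge hn one_pos le_rfl
    rw [leftTangent_polygonalCurve i h1 h2]
    exact smul_ne_zero hn' (edgeVector_ne_zero hn hp i)
  regular := by
    intro t ht hs
    have hn' : (0 : ℝ) < n := by exact_mod_cast hn
    obtain ⟨i, h1, h2⟩ := exists_left_edge hn ht.1 ht.2.le
    obtain ⟨j, g1, g2⟩ := exists_right_edge hn ht.1.le ht.2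
    rw [leftTangent_polygonalCurve i h1 h2, rightTangent_polygonalCurve j g1 g2] at hs
    obtain ⟨r, r', hr, hr', e⟩ := hs.exists_pos (smul_ne_zero hn'.ne' (edgeVector_ne_zero hn hp i))
      (neg_ne_zero.2 (smul_ne_zero hn'.ne' (edgeVector_ne_zero hn hp j)))
    -- With antiparallel tangents the curve would retrace itself: the points at `t - ε * r` and `t +
    -- ε * r'` coincide. The choice of `ε` keeps both on the edges adjacent to `t`.
    obtain ⟨ε, hε, k1, k2⟩ : ∃ ε : ℝ, 0 < ε ∧ n * (ε * r) ≤ n * t - i ∧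
        n * (ε * r') ≤ j + 1 - n * t := by
      refine ⟨min ((n * t - i) / (n * r)) ((j + 1 - n * t) / (n * r')), ?_, ?_, ?_⟩
      · refine lt_min (div_pos (by linarith) (by positivity)) (div_pos (by linarith) (by positivity))
      · rw [show ∀ x : ℝ, n * (x * r) = x * (n * r) by intro x; ring, ← le_div_iff₀ (by positivity)]
        exact min_le_left _ _
      · rw [show ∀ x : ℝ, n * (x * r') = x * (n * r') by intro x; ring,
          ← le_div_iff₀ (by positivity)]
        exact min_le_right _ _
    have q1 : 0 < ε * r := by positivity
    have q2 : 0 < ε * r' := by positivity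
    have q3 : 0 < n * (ε * r) := by positivity
    have q4 : 0 < n * (ε * r') := by positivity
    have hi : (0 : ℝ) ≤ (i : ℕ) := Nat.cast_nonneg _
    have hj : ((j : ℕ) : ℝ) + 1 ≤ n := by exact_mod_cast j.2
    have c1 := polygonalCurve_eq (p := p) i (t := t - ε * r) (by linarith) (by linarith)
    have c2 := polygonalCurve_eq (p := p) i h1.le h2
    have c3 := polygonalCurve_eq (p := p) j (t := t + ε * r') (by linarith) (by linarith)
    have c4 := polygonalCurve_eq (p := p) j g1 g2.le
    have b1 : 0 ≤ t - ε * r := by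
      by_contra! hcon
      nlinarith
    have b2 : t + ε * r' ≤ 1 := by
      by_contra! hcon
      nlinarith
    have heq : polygonalCurve p (t - ε * r) = polygonalCurve p (t + ε * r') := by
      have e1 : polygonalCurve p (t - ε * r) =
          polygonalCurve p t - (ε * (n * r)) • edgeVector p i := by
        rw [c1, c2, add_sub_assoc, ← sub_smul]; congr 2; ring
      have e2 : polygonalCurve p (t + ε * r') =
          polygonalCurve p t + (ε * (n * r')) • edgeVector p j := by
        rw [c3, c4, add_assoc, ← add_smul]; congr 2; ring
      rw [e1, e2, sub_eq_add_neg]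
      congr 1
      rw [smul_smul, smul_neg, smul_smul] at e
      rw [mul_comm (n : ℝ) r, mul_comm (n : ℝ) r', mul_smul, mul_smul ε (r' * n), e, smul_neg,
        neg_neg]
    have := hp ⟨b1, by linarith⟩ ⟨by linarith, b2⟩ heq
    linarith

end Polygon

/-! ### Generic projections of polygonal chains -/

section PolygonProjection

variable {n : ℕ} {p : Fin (n + 1) → E3} {ξ : Direction}

/-- The directions in which the projection of the polygonal chain is generic: the direction is not
parallel to the planes spanned by two edges, by an edge and a vertex, or by two coplanar edges, and
no line of this direction meets three pairwise skew edges. -/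
structure IsRegularDirection (p : Fin (n + 1) → E3) (ξ : Direction) : Prop where
  edge_edge : ∀ i j : Fin n, ∀ x y : ℝ, (ξ : E3) ≠ x • edgeVector p i + y • edgeVector p j
  edge_vertex : ∀ (i : Fin n) (k : Fin (n + 1)), ∀ x y : ℝ,
    (ξ : E3) ≠ x • edgeVector p i + y • (p k - p i.castSucc)
  coplanar : ∀ i j : Fin n,
    tripleProduct (edgeVector p i) (edgeVector p j) (p i.castSucc - p j.castSucc) = 0 →
      ∀ x y z : ℝ, (ξ : E3) ≠
        x • edgeVector p i + y • edgeVector p j + z • (p i.castSucc - p j.castSucc)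
  skew : ∀ i j : Fin n,
    tripleProduct (edgeVector p i) (edgeVector p j) (p i.castSucc - p j.castSucc) ≠ 0 →
      tripleProduct (edgeVector p i) (edgeVector p j) ξ ≠ 0
  triple : ∀ i j k : Fin n,
    tripleProduct (edgeVector p i) (edgeVector p k) (p i.castSucc - p k.castSucc) ≠ 0 →
    tripleProduct (edgeVector p j) (edgeVector p k) (p j.castSucc - p k.castSucc) ≠ 0 →
      ∀ s t l : ℝ, tripleProduct (p i.castSucc + s • edgeVector p i - p k.castSucc)
        (p j.castSucc + t • edgeVector p j - p k.castSucc) (edgeVector p k) = 0 →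
        (ξ : E3) ≠ l • (p j.castSucc + t • edgeVector p j -
          (p i.castSucc + s • edgeVector p i))

theorem ae_isRegularDirection (p : Fin (n + 1) → E3) :
    ∀ᵐ ξ ∂sphereArea, IsRegularDirection p ξ := by
  have h1 : ∀ᵐ ξ : Direction ∂sphereArea, ∀ i j : Fin n, ∀ x y : ℝ,
      (ξ : E3) ≠ x • edgeVector p i + y • edgeVector p j :=
    ae_all_iff.2 fun i => ae_all_iff.2 fun j => ae_sphereArea_ne_span_pair _ _
  have h2 : ∀ᵐ ξ : Direction ∂sphereArea, ∀ (i : Fin n) (k : Fin (n + 1)), ∀ x y : ℝ,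
      (ξ : E3) ≠ x • edgeVector p i + y • (p k - p i.castSucc) :=
    ae_all_iff.2 fun i => ae_all_iff.2 fun j => ae_sphereArea_ne_span_pair _ _
  have h3 : ∀ᵐ ξ : Direction ∂sphereArea, ∀ i j : Fin n,
      tripleProduct (edgeVector p i) (edgeVector p j) (p i.castSucc - p j.castSucc) = 0 →
        ∀ x y z : ℝ, (ξ : E3) ≠
          x • edgeVector p i + y • edgeVector p j + z • (p i.castSucc - p j.castSucc) :=
    ae_all_iff.2 fun i => ae_all_iff.2 fun j => Filter.eventually_imp_distrib_left.2
      fun h => ae_sphereArea_ne_span h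
  have h4 : ∀ᵐ ξ : Direction ∂sphereArea, ∀ i j : Fin n,
      tripleProduct (edgeVector p i) (edgeVector p j) (p i.castSucc - p j.castSucc) ≠ 0 →
        tripleProduct (edgeVector p i) (edgeVector p j) ξ ≠ 0 :=
    ae_all_iff.2 fun i => ae_all_iff.2 fun j => Filter.eventually_imp_distrib_left.2
      fun h => ae_sphereArea_tripleProduct_ne_zero h
  have h5 : ∀ᵐ ξ : Direction ∂sphereArea, ∀ i j k : Fin n,
      tripleProduct (edgeVector p i) (edgeVector p k) (p i.castSucc - p k.castSucc) ≠ 0 →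
      tripleProduct (edgeVector p j) (edgeVector p k) (p j.castSucc - p k.castSucc) ≠ 0 →
        ∀ s t l : ℝ, tripleProduct (p i.castSucc + s • edgeVector p i - p k.castSucc)
          (p j.castSucc + t • edgeVector p j - p k.castSucc) (edgeVector p k) = 0 →
          (ξ : E3) ≠ l • (p j.castSucc + t • edgeVector p j -
            (p i.castSucc + s • edgeVector p i)) :=
    ae_all_iff.2 fun i => ae_all_iff.2 fun j => ae_all_iff.2 fun k =>
      Filter.eventually_imp_distrib_left.2 fun h => Filter.eventually_imp_distrib_left.2
        fun h' => ae_sphereArea_not_transversal h h'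
  filter_upwards [h1, h2, h3, h4, h5] with ξ a b c d e using ⟨a, b, c, d, e⟩

/-- As `ξ` is not in the span of `u` and `v`, the projection is injective on it, and a relation
between the projections lifts to `u` and `v`. -/
theorem not_sameRay_projectAlong {u v : E3} (h : ¬ SameRay ℝ u (-v))
    (hξ : ∀ x y : ℝ, (ξ : E3) ≠ x • u + y • v) :
    ¬ SameRay ℝ (projectAlong ξ u) (-projectAlong ξ v) := by
  have key (x y : ℝ) (hxy : x • u + y • v ≠ 0) : projectAlong ξ (x • u + y • v) ≠ 0 := by
    intro h0
    obtain ⟨l, hl⟩ := projectAlong_eq_zero_iff.1 h0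
    have hl0 : l ≠ 0 := by
      rintro rfl
      exact hxy (by rw [hl, zero_smul])
    refine hξ (l⁻¹ * x) (l⁻¹ * y) ?_
    rw [mul_smul, mul_smul, ← smul_add, hl, inv_smul_smul₀ hl0]
  have hu : u ≠ 0 := by rintro rfl; exact h (SameRay.zero_left _)
  have hv : v ≠ 0 := by rintro rfl; exact h (by rw [neg_zero]; exact SameRay.zero_right _)
  have hPu : projectAlong ξ u ≠ 0 := by simpa using key 1 0 (by simpa using hu)
  have hPv : projectAlong ξ v ≠ 0 := by simpa using key 0 1 (by simpa using hv)
  intro hs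
  obtain ⟨r, r', hr, hr', e⟩ := hs.exists_pos hPu (neg_ne_zero.2 hPv)
  refine key r r' ?_ ?_
  · intro h0
    refine h (Or.inr (Or.inr ⟨r, r', hr, hr', ?_⟩))
    rw [smul_neg]
    exact eq_neg_of_add_eq_zero_left h0
  · rw [projectAlong_add, projectAlong_smul, projectAlong_smul, e, smul_neg, neg_add_cancel]

namespace IsRegularDirection

/-- Edges of a simple polygonal curve that meet a common line in a regular direction are skew. -/
theorem skew_of_line (h : IsRegularDirection p ξ) (hp : InjOn (polygonalCurve p) (Icc 0 1))
    {s t l : ℝ} (hs : s ∈ Icc (0 : ℝ) 1) (ht : t ∈ Icc (0 : ℝ) 1) (hst : s ≠ t)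
    (e : polygonalCurve p s - polygonalCurve p t = l • (ξ : E3)) {i j : Fin n}
    (hi1 : (i : ℝ) ≤ n * s) (hi2 : n * s ≤ i + 1) (hj1 : (j : ℝ) ≤ n * t) (hj2 : n * t ≤ j + 1) :
    tripleProduct (edgeVector p i) (edgeVector p j) (p i.castSucc - p j.castSucc) ≠ 0 := by
  have hl : l ≠ 0 := by
    rintro rfl
    rw [zero_smul, sub_eq_zero] at e
    exact hst (hp hs ht e)
  intro h0
  -- Otherwise the chord, a nonzero multiple of `ξ`, would be a combination of the two edge vectors
  -- and the difference of their base points, which are coplanar.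
  refine h.coplanar i j h0 (l⁻¹ * (n * s - i)) (l⁻¹ * -(n * t - j)) l⁻¹ ?_
  rw [mul_smul, mul_smul, ← smul_add, ← smul_add, eq_inv_smul_iff₀ hl, ← e,
    polygonalCurve_eq i hi1 hi2, polygonalCurve_eq j hj1 hj2, neg_smul]
  abel

/-- A vertex on the line would place `ξ` in the span of an edge vector and the difference between
this vertex and the start of that edge. -/
theorem ne_vertex (hn : 1 ≤ n) (h : IsRegularDirection p ξ)
    (hp : InjOn (polygonalCurve p) (Icc 0 1)) {s t l : ℝ} (hs : s ∈ Icc (0 : ℝ) 1)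
    (ht : t ∈ Icc (0 : ℝ) 1) (hst : s ≠ t)
    (e : polygonalCurve p s - polygonalCurve p t = l • (ξ : E3)) (k : Fin (n + 1)) :
    n * s ≠ k := by
  have hl : l ≠ 0 := by
    rintro rfl
    rw [zero_smul, sub_eq_zero] at e
    exact hst (hp hs ht e)
  intro hk
  obtain ⟨j, hj1, hj2⟩ := exists_edge hn ht
  rw [polygonalCurve_vertex hn k hk, polygonalCurve_eq j hj1 hj2] at e
  refine h.edge_vertex j k (l⁻¹ * -(n * t - j)) l⁻¹ ?_
  rw [mul_smul, ← smul_add, eq_inv_smul_iff₀ hl, ← e, neg_smul]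
  abel

theorem hasDerivAt (hn : 1 ≤ n) (h : IsRegularDirection p ξ)
    (hp : InjOn (polygonalCurve p) (Icc 0 1)) {s t l : ℝ} (hs : s ∈ Icc (0 : ℝ) 1)
    (ht : t ∈ Icc (0 : ℝ) 1) (hst : s ≠ t)
    (e : polygonalCurve p s - polygonalCurve p t = l • (ξ : E3)) {i : Fin n}
    (hi1 : (i : ℝ) ≤ n * s) (hi2 : n * s ≤ i + 1) :
    HasDerivAt (polygonalCurve p) ((n : ℝ) • edgeVector p i) s := by
  refine hasDerivAt_polygonalCurve i (lt_of_le_of_ne hi1 ?_) (lt_of_le_of_ne hi2 ?_)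
  · intro hk
    exact h.ne_vertex hn hp hs ht hst e i.castSucc (by simp [hk])
  · intro hk
    exact h.ne_vertex hn hp hs ht hst e i.succ (by simp [hk])

/-- The line would meet three edges, two of them skew to the third; such directions are excluded by
`triple`. This rules out triple points of the projection. -/
theorem false_of_three_points (hn : 1 ≤ n) (h : IsRegularDirection p ξ)
    (hp : InjOn (polygonalCurve p) (Icc 0 1)) {s t r l l' : ℝ} (hs : s ∈ Icc (0 : ℝ) 1)
    (ht : t ∈ Icc (0 : ℝ) 1) (hr : r ∈ Icc (0 : ℝ) 1) (hst : s ≠ t) (hsr : s ≠ r) (htr : t ≠ r)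
    (e : polygonalCurve p s - polygonalCurve p r = l • (ξ : E3))
    (e' : polygonalCurve p t - polygonalCurve p r = l' • (ξ : E3)) : False := by
  obtain ⟨i, hi1, hi2⟩ := exists_edge hn hs
  obtain ⟨j, hj1, hj2⟩ := exists_edge hn ht
  obtain ⟨k, hk1, hk2⟩ := exists_edge hn hr
  have s1 := h.skew_of_line hp hs hr hsr e hi1 hi2 hk1 hk2
  have s2 := h.skew_of_line hp ht hr htr e' hj1 hj2 hk1 hk2
  have e'' : polygonalCurve p t - polygonalCurve p s = (l' - l) • (ξ : E3) := by
    rw [sub_smul, ← e, ← e']; abel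
  have hl : l' - l ≠ 0 := by
    intro h0
    rw [h0, zero_smul, sub_eq_zero] at e''
    exact hst (hp hs ht e''.symm)
  refine h.triple i j k s1 s2 (n * s - i) (n * t - j) (l' - l)⁻¹ ?_ ?_
  · rw [← polygonalCurve_eq i hi1 hi2, ← polygonalCurve_eq j hj1 hj2]
    have k1 : polygonalCurve p s - p k.castSucc =
        l • (ξ : E3) + (n * r - k) • edgeVector p k := by
      rw [← e, polygonalCurve_eq k hk1 hk2]; abel
    have k2 : polygonalCurve p t - p k.castSucc =
        l' • (ξ : E3) + (n * r - k) • edgeVector p k := by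
      rw [← e', polygonalCurve_eq k hk1 hk2]; abel
    rw [k1, k2]
    simp only [tripleProduct_eq, PiLp.add_apply, PiLp.smul_apply, smul_eq_mul]
    ring
  · rw [← polygonalCurve_eq i hi1 hi2, ← polygonalCurve_eq j hj1 hj2, e'', inv_smul_smul₀ hl]

/-- A crossing is determined by its pair of edges: on skew edges the crossing equation is a linear
system with nonzero determinant. -/
theorem exists_injOn_crossings (hn : 1 ≤ n) (h : IsRegularDirection p ξ)
    (hp : InjOn (polygonalCurve p) (Icc 0 1)) :
    ∃ f : ℝ × ℝ → Fin n × Fin n, InjOn f (crossings (polygonalCurve p) ξ) := by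
  have : Nonempty (Fin n) := ⟨⟨0, hn⟩⟩
  choose! E hE1 hE2 using fun (t : ℝ) (ht : t ∈ Icc (0 : ℝ) 1) => exists_edge hn ht
  refine ⟨fun q => (E q.1, E q.2), fun q hq r hr hqr => ?_⟩
  obtain ⟨a1, a2, a3, l, hl⟩ := mem_crossings_iff.1 hq
  obtain ⟨b1, b2, b3, l', hl'⟩ := mem_crossings_iff.1 hr
  have q1 : q.1 ∈ Icc (0 : ℝ) 1 := ⟨a1, a2.le.trans a3⟩
  have q2 : q.2 ∈ Icc (0 : ℝ) 1 := ⟨a1.trans a2.le, a3⟩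
  have r1 : r.1 ∈ Icc (0 : ℝ) 1 := ⟨b1, b2.le.trans b3⟩
  have r2 : r.2 ∈ Icc (0 : ℝ) 1 := ⟨b1.trans b2.le, b3⟩
  simp only [Prod.mk.injEq] at hqr
  have hsk := h.skew _ _ (h.skew_of_line hp q1 q2 a2.ne hl (hE1 _ q1) (hE2 _ q1) (hE1 _ q2)
    (hE2 _ q2))
  rw [polygonalCurve_eq _ (hE1 _ q1) (hE2 _ q1), polygonalCurve_eq _ (hE1 _ q2) (hE2 _ q2)] at hl
  rw [polygonalCurve_eq _ (hE1 _ r1) (hE2 _ r1), polygonalCurve_eq _ (hE1 _ r2) (hE2 _ r2),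
    ← hqr.1, ← hqr.2] at hl'
  obtain ⟨z1, z2, -⟩ := eq_zero_of_tripleProduct_ne_zero hsk (x := n * (q.1 - r.1))
    (y := -(n * (q.2 - r.2))) (z := -(l - l')) (by
      have : l • (ξ : E3) - l' • (ξ : E3) - (l - l') • (ξ : E3) = 0 := by
        rw [sub_smul, sub_self]
      rw [← hl, ← hl'] at this
      rw [← this]
      module)
  have hn' : (n : ℝ) ≠ 0 := by positivity
  simp only [neg_eq_zero, mul_eq_zero, hn', false_or, sub_eq_zero] at z1 z2
  exact Prod.ext z1 z2

theorem ncard_crossings_le (hn : 1 ≤ n) (h : IsRegularDirection p ξ)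
    (hp : InjOn (polygonalCurve p) (Icc 0 1)) :
    (crossings (polygonalCurve p) ξ).ncard ≤ n * n := by
  obtain ⟨f, hf⟩ := h.exists_injOn_crossings hn hp
  have := ncard_le_ncard_of_injOn f (fun q _ => mem_univ (f q)) hf
  simpa [ncard_univ] using this

theorem isGenericProjection (hn : 1 ≤ n) (h : IsRegularDirection p ξ)
    (hp : InjOn (polygonalCurve p) (Icc 0 1)) : IsGenericProjection (polygonalCurve p) ξ := by
  have hn' : (n : ℝ) ≠ 0 := by positivity
  have hproj (i : Fin n) : projectAlong ξ ((n : ℝ) • edgeVector p i) ≠ 0 := by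
    intro h0
    obtain ⟨l, hl⟩ := projectAlong_eq_zero_iff.1 h0
    have hl0 : l ≠ 0 := by
      rintro rfl
      rw [zero_smul] at hl
      exact smul_ne_zero hn' (edgeVector_ne_zero hn hp i) hl
    refine h.edge_edge i i (l⁻¹ * n) 0 ?_
    rw [zero_smul, add_zero, mul_smul, hl, inv_smul_smul₀ hl0]
  have data {q : ℝ × ℝ} (hq : q ∈ crossings (polygonalCurve p) ξ) :
      q.1 ∈ Icc (0 : ℝ) 1 ∧ q.2 ∈ Icc (0 : ℝ) 1 ∧ q.1 ≠ q.2 ∧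
        (∃ l : ℝ, polygonalCurve p q.1 - polygonalCurve p q.2 = l • (ξ : E3)) ∧
        ∃ l : ℝ, polygonalCurve p q.2 - polygonalCurve p q.1 = l • (ξ : E3) := by
    obtain ⟨a1, a2, a3, l, hl⟩ := mem_crossings_iff.1 hq
    exact ⟨⟨a1, a2.le.trans a3⟩, ⟨a1.trans a2.le, a3⟩, a2.ne, ⟨l, hl⟩, -l, by
      rw [neg_smul, ← hl]; abel⟩
  have hderiv {q : ℝ × ℝ} (hq : q ∈ crossings (polygonalCurve p) ξ) :
      ∃ i j : Fin n, HasDerivAt (polygonalCurve p) ((n : ℝ) • edgeVector p i) q.1 ∧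
        HasDerivAt (polygonalCurve p) ((n : ℝ) • edgeVector p j) q.2 ∧
        tripleProduct (edgeVector p i) (edgeVector p j) ξ ≠ 0 := by
    obtain ⟨q1, q2, hne, ⟨l, hl⟩, l', hl'⟩ := data hq
    obtain ⟨i, hi1, hi2⟩ := exists_edge hn q1
    obtain ⟨j, hj1, hj2⟩ := exists_edge hn q2
    exact ⟨i, j, h.hasDerivAt hn hp q1 q2 hne hl hi1 hi2,
      h.hasDerivAt hn hp q2 q1 hne.symm hl' hj1 hj2,
      h.skew _ _ (h.skew_of_line hp q1 q2 hne hl hi1 hi2 hj1 hj2)⟩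
  refine ⟨?_, ?_, ?_, ?_, ?_, ?_, ?_, ?_⟩
  · obtain ⟨f, hf⟩ := h.exists_injOn_crossings hn hp
    exact Finite.of_injOn (mapsTo_univ f _) hf finite_univ
  · obtain ⟨i, h1, h2⟩ := exists_right_edge hn le_rfl one_pos
    rw [rightTangent_polygonalCurve i h1 h2]
    exact hproj i
  · obtain ⟨i, h1, h2⟩ := exists_left_edge hn one_pos le_rfl
    rw [leftTangent_polygonalCurve i h1 h2]
    exact hproj i
  · intro t ht
    have hreg := (isSimpleOpenCurve_polygonalCurve hn hp).regular t ht
    obtain ⟨i, h1, h2⟩ := exists_left_edge hn ht.1 ht.2.le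
    obtain ⟨j, g1, g2⟩ := exists_right_edge hn ht.1.le ht.2
    rw [leftTangent_polygonalCurve i h1 h2, rightTangent_polygonalCurve j g1 g2] at hreg ⊢
    refine not_sameRay_projectAlong hreg fun x y => ?_
    rw [smul_smul, smul_smul]
    exact h.edge_edge i j _ _
  · intro q hq
    obtain ⟨q1, q2, hne, ⟨l, hl⟩, l', hl'⟩ := data hq
    refine ⟨lt_of_le_of_ne q1.1 fun h0 => ?_, lt_of_le_of_ne q2.2 fun h0 => ?_⟩
    · exact h.ne_vertex hn hp q1 q2 hne hl 0 (by rw [← h0]; simp)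
    · exact h.ne_vertex hn hp q2 q1 hne.symm hl' (Fin.last n) (by rw [h0]; simp)
  · intro q hq
    obtain ⟨i, j, h1, h2, -⟩ := hderiv hq
    exact ⟨h1.differentiableAt, h2.differentiableAt⟩
  · intro q hq
    obtain ⟨i, j, h1, h2, h3⟩ := hderiv hq
    rw [h1.deriv, h2.deriv, ← one_smul ℝ (ξ : E3), tripleProduct_smul_smul_smul]
    exact mul_ne_zero (by simpa using hn') h3
  · intro q hq r hr hqr
    obtain ⟨q1, q2, qne, ⟨l, hl⟩, l', hl'⟩ := data hq
    obtain ⟨r1, r2, rne, ⟨m, hm⟩, m', hm'⟩ := data hr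
    have qlt := hq.2.1
    have rlt := hr.2.1
    by_contra hne
    rcases hqr with e | e | e | e
    · have hd : q.2 ≠ r.2 := fun h0 => hne (Prod.ext e h0)
      rw [← e] at hm'
      exact h.false_of_three_points hn hp q2 r2 q1 hd qne.symm (e ▸ rne.symm) hl' hm'
    · have hd : q.2 ≠ r.1 := by linarith
      rw [← e] at hm
      exact h.false_of_three_points hn hp q2 r1 q1 hd qne.symm (e ▸ rne) hl' hm
    · have hd : q.1 ≠ r.2 := by linarith
      rw [← e] at hm'
      exact h.false_of_three_points hn hp q1 r2 q2 hd qne (e ▸ rne.symm) hl hm'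
    · have hd : q.1 ≠ r.1 := fun h0 => hne (Prod.ext h0 e)
      rw [← e] at hm
      exact h.false_of_three_points hn hp q1 r1 q2 hd qne (e ▸ rne) hl hm

end IsRegularDirection

theorem isTameOpenCurve_polygonalCurve (hn : 1 ≤ n) (hp : InjOn (polygonalCurve p) (Icc 0 1)) :
    IsTameOpenCurve (n * n) (polygonalCurve p) where
  toIsSimpleOpenCurve := isSimpleOpenCurve_polygonalCurve hn hp
  generic := (ae_isRegularDirection p).mono fun _ hξ =>
    ⟨hξ.isGenericProjection hn hp, hξ.ncard_crossings_le hn hp⟩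

/-! ### Dependence of the polygonal curve on its vertices -/

theorem abs_clamp_sub_clamp_le (x y : ℝ) :
    |max 0 (min 1 x) - max 0 (min 1 y)| ≤ |x - y| := by
  have := abs_projIcc_sub_projIcc (zero_le_one (α := ℝ)) (c := x) (d := y)
  simpa [coe_projIcc] using this

/-- An edge vector changes by at most `2 * d`, where `d = dist p q`. The positions thus differ by at
most `d + n * (2 * d)`. Each coefficient is `n`-Lipschitz in `t`, so the difference has Lipschitz
constant at most `n * n * (2 * d)`; the stated constant dominates both. -/
theorem isC1Close_polygonalCurve (p q : Fin (n + 1) → E3) :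
    IsC1Close ((1 + 2 * n + 2 * n * n) * dist p q) (polygonalCurve p) (polygonalCurve q) := by
  set d := dist p q with hd
  have hd0 : 0 ≤ d := dist_nonneg
  have hn : (0 : ℝ) ≤ n := Nat.cast_nonneg n
  have hv (k : Fin (n + 1)) : ‖p k - q k‖ ≤ d := by
    rw [← dist_eq_norm]; exact dist_le_pi_dist p q k
  have he (i : Fin n) : ‖edgeVector p i - edgeVector q i‖ ≤ 2 * d := by
    calc _ = ‖(p i.succ - q i.succ) - (p i.castSucc - q i.castSucc)‖ := by
          rw [edgeVector, edgeVector]; congr 1; abel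
      _ ≤ _ := norm_sub_le _ _
      _ ≤ _ := by linarith [hv i.succ, hv i.castSucc]
  have hdiff (t : ℝ) : polygonalCurve p t - polygonalCurve q t = (p 0 - q 0) +
      ∑ i : Fin n, max 0 (min 1 (n * t - i)) • (edgeVector p i - edgeVector q i) := by
    simp only [polygonalCurve, edgeVector, smul_sub, Finset.sum_sub_distrib]
    abel
  constructor
  · intro t _
    rw [hdiff]
    have : ‖∑ i : Fin n, max 0 (min 1 (n * t - i)) • (edgeVector p i - edgeVector q i)‖
        ≤ ∑ _i : Fin n, 2 * d := by
      refine norm_sum_le_of_le _ fun i _ => ?_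
      rw [norm_smul, Real.norm_of_nonneg (le_max_left _ _)]
      have h1 : max 0 (min 1 (n * t - i)) ≤ (1 : ℝ) := max_le zero_le_one (min_le_left _ _)
      calc _ ≤ 1 * (2 * d) := by gcongr; exact he i
        _ = _ := one_mul _
    rw [Finset.sum_const, Finset.card_univ, Fintype.card_fin, nsmul_eq_mul] at this
    have h2 : 0 ≤ 2 * n * n * d := by positivity
    refine (norm_add_le _ _).trans ?_
    linarith [hv 0]
  · intro s _ t _
    rw [hdiff, hdiff, add_sub_add_left_eq_sub, ← Finset.sum_sub_distrib]
    have : ‖∑ i : Fin n, (max 0 (min 1 (n * s - i)) • (edgeVector p i - edgeVector q i) -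
        max 0 (min 1 (n * t - i)) • (edgeVector p i - edgeVector q i))‖
        ≤ ∑ _i : Fin n, n * |s - t| * (2 * d) := by
      refine norm_sum_le_of_le _ fun i _ => ?_
      rw [← sub_smul, norm_smul, Real.norm_eq_abs]
      have h1 := abs_clamp_sub_clamp_le (n * s - i) (n * t - i)
      rw [sub_sub_sub_cancel_right, ← mul_sub, abs_mul, abs_of_nonneg hn] at h1
      gcongr
      exact he i
    rw [Finset.sum_const, Finset.card_univ, Fintype.card_fin, nsmul_eq_mul] at this
    have h2 : 0 ≤ (1 + 2 * n) * d * |s - t| := by positivity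
    linarith

theorem continuous_bracketVector_polygonalCurve (hn : 1 ≤ n) (m : ℕ) :
    Continuous fun p : OpenPolygonalChain n => bracketVector m (polygonalCurve p.1) := by
  rw [Metric.continuous_iff]
  intro p ε hε
  obtain ⟨δ, hδ, H⟩ :=
    (isTameOpenCurve_polygonalCurve hn p.2).exists_dist_bracketVector_lt m hε
  have hK : (0 : ℝ) < 1 + 2 * n + 2 * n * n := by positivity
  refine ⟨δ / (1 + 2 * n + 2 * n * n), by positivity, fun q hq => ?_⟩
  rw [dist_comm]
  refine H _ (isTameOpenCurve_polygonalCurve hn q.2) ((isC1Close_polygonalCurve p.1 q.1).mono ?_)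
  rw [dist_comm, Subtype.dist_eq, lt_div_iff₀ hK, mul_comm] at hq
  exact hq.le

end PolygonProjection

end

theorem mainTheorem4 :
    (∀ n : ℕ, 1 ≤ n → ∃ m : ℕ,
      (∀ p : OpenPolygonalChain n, HasNormalizedBracket (polygonalCurve p.1) m) ∧
      Continuous fun p : OpenPolygonalChain n => bracketVector m (polygonalCurve p.1)) ∧
    (∀ M : ℕ, ∃ m : ℕ,
      (∀ γ : ℝ → E3, IsTameOpenCurve M γ → HasNormalizedBracket γ m) ∧
      ∀ γ : ℝ → E3, IsTameOpenCurve M γ → ∀ ε : ℝ, 0 < ε → ∃ δ : ℝ, 0 < δ ∧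
        ∀ η : ℝ → E3, IsTameOpenCurve M η → IsC1Close δ γ η →
          dist (bracketVector m γ) (bracketVector m η) < ε) := by
  refine ⟨fun n hn => ?_, fun M => ?_⟩
  · obtain ⟨m, hm⟩ := exists_degree_bound (n * n)
    exact ⟨m, fun p => (isTameOpenCurve_polygonalCurve hn p.2).hasNormalizedBracket hm,
      continuous_bracketVector_polygonalCurve hn m⟩
  · obtain ⟨m, hm⟩ := exists_degree_bound M
    exact ⟨m, fun γ hγ => hγ.hasNormalizedBracket hm,
      fun γ hγ ε hε => hγ.exists_dist_bracketVector_lt m hε⟩
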